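/- Let $\beta>1$ be a real number and let $T_\beta x=\beta x-\lfloor \beta x\rfloor$ be the $\beta$-transformation on $[0,1]$. For $x\in[0,1]$, let $v_\beta(x)\in[-\infty,+\infty]$ be the supremum of the real numbers $v$ for which $T_\beta^n x<(\beta^n)^{-v}$ has infinitely many solutions in positive integers $n$, and let $\hat v_\beta(x)\in[-\infty,+\infty]$ be the supremum of the real numbers $v$ for which, for every sufficiently large integer $N$, the inequality $T_\beta^n x<(\beta^N)^{-v}$ has a solution $n$ with $1\le n\le N$. Let $\dim$ denote Hausdorff dimension. Let $\theta$ and $\hat v$ be positive real numbers with $\hat v<1$. If $\theta<1/(1-\hat v)$, then the set $$\{x\in[0,1]:\hat v_\beta(x)\ge \hat v\}\cap\{x\in[0,1]:v_\beta(x)=\theta\hat v\}$$ is empty. Otherwise, $$\dim\bigl(\{x\in[0,1]:\hat v_\beta(x)=\hat v\}\cap\{x\in[0,1]:v_\beta(x)=\theta\hat v\}\bigr)=\frac{\theta-1-\theta\hat v}{(1+\theta\hat v)(\theta-1)}.$$ Furthermore, $\dim\{x\in[0,1]:\hat v_\beta(x)=1\}=0$. -/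

import Mathlib

open Set Filter

noncomputable section

/-- The `β`-transformation `T_β x = β x - ⌊β x⌋`. It maps `[0, 1]` to itself; only its values on
`[0, 1]` are used below. -/
def betaMap (β : ℝ) (x : ℝ) : ℝ := β * x - (⌊β * x⌋ : ℝ)

/-- The exponent `v_β(x)`: the supremum, in `[-∞, +∞]`, of the real numbers `v` for which
`T_β^n x < (β^n)^(-v)` has infinitely many solutions in positive integers `n`. -/
def betaExp (β x : ℝ) : EReal :=
  sSup ((fun v : ℝ => (v : EReal)) ''
    {v : ℝ | {n : ℕ | 1 ≤ n ∧ (betaMap β)^[n] x < (β ^ n) ^ (-v)}.Infinite})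

/-- The uniform exponent `v̂_β(x)`: the supremum, in `[-∞, +∞]`, of the real numbers `v` for which,
for every sufficiently large integer `N`, the inequality `T_β^n x < (β^N)^(-v)` has a solution `n`
with `1 ≤ n ≤ N`. -/
def betaUniformExp (β x : ℝ) : EReal :=
  sSup ((fun v : ℝ => (v : EReal)) ''
    {v : ℝ | ∀ᶠ N : ℕ in atTop, ∃ n : ℕ, 1 ≤ n ∧ n ≤ N ∧
      (betaMap β)^[n] x < (β ^ N) ^ (-v)})

end

/-! Write `T` for `betaMap β`. A small value `T^r x` means a run of zero digits: `T` then acts as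
multiplication by `β` until the value reaches `β^(-1)`. Let `n` be a record time, `r` the last
record time before it, and suppose the uniform exponent exceeds `w`. Then `T^r x < β^(-w(n-1))`, and
the orbit must leave the run before it can set a new record, so `n - r > w(n-1)`
(`IsRecordTime.exists_previous`). If also `T^r x ≥ β^(-(ur+c))`, then `w(n-1) < ur + c`. For large
`n` the two inequalities are compatible only if `u ≥ v/(1-v)` (`div_one_sub_le_of_betaExp_lt`). This
gives the empty level sets, and shows that uniform exponent `1` forces `v_β = ∞`, a set of dimension
zero by the natural covers.

Upper bound: a cylinder of order `n` ending at a record time is a record cylinder of order `r`, a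
forced run of about `wn` zeros, and an arbitrary cylinder of order `n - r - wn`, with `r` at least
about `wn/u`. This recursion bounds the number of such cylinders by `K β^(τn)` for every `τ > 1 -
θv/(θ-1)` (`exists_ncard_recordEndpoints_le`). Intervals of length about `β^(-(1+θv)n)` cover the
set, so its dimension is at most `(1 - θv/(θ-1))/(1+θv)`, the stated value.

Lower bound: zeros are imposed on the blocks from `Aθ^i` to `(1+θv)Aθ^i` and nonzero full cylinder
words are written freely elsewhere. The proportion of free positions is lowest at the end of a zero
block, where it is the same value. Full words concatenate freely, and there are at least `β^n/(n+1)`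
of them (`pow_le_ncard_fullOffsets`), so filling the free positions with the base `M` digits of `s ∈
[0,1)` gives a map whose inverse is Hölder with exponent arbitrarily close to that value. -/

/-! ### Elementary properties of the iterates -/

theorem betaMap_eq_fract (β x : ℝ) : betaMap β x = Int.fract (β * x) := rfl

theorem betaMap_nonneg (β x : ℝ) : 0 ≤ betaMap β x := Int.fract_nonneg _

theorem betaMap_lt_one (β x : ℝ) : betaMap β x < 1 := Int.fract_lt_one _

theorem betaMap_le_mul {β x : ℝ} (hβ : 1 < β) (hx : 0 ≤ x) : betaMap β x ≤ β * x := by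
  have h : (0 : ℝ) ≤ ⌊β * x⌋ := by
    exact_mod_cast Int.floor_nonneg.2 (by positivity)
  unfold betaMap
  linarith

theorem betaMap_eq_mul {β x : ℝ} (hβ : 1 < β) (hx : 0 ≤ x) (h : β * x < 1) :
    betaMap β x = β * x :=
  Int.fract_eq_self.2 ⟨by positivity, h⟩

theorem betaMap_iterate_nonneg (β : ℝ) {x : ℝ} (hx : 0 ≤ x) (n : ℕ) :
    0 ≤ (betaMap β)^[n] x := by
  cases n with
  | zero => simpa using hx
  | succ n => rw [Function.iterate_succ_apply']; exact betaMap_nonneg _ _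

theorem betaMap_iterate_lt_one_of_pos (β x : ℝ) {n : ℕ} (hn : 1 ≤ n) :
    (betaMap β)^[n] x < 1 := by
  obtain ⟨m, rfl⟩ := Nat.exists_eq_add_of_le' hn
  rw [Function.iterate_succ_apply']
  exact betaMap_lt_one _ _

theorem betaMap_iterate_mem_Ico (β : ℝ) {x : ℝ} (hx : x ∈ Ico (0 : ℝ) 1) (n : ℕ) :
    (betaMap β)^[n] x ∈ Ico (0 : ℝ) 1 := by
  refine ⟨betaMap_iterate_nonneg β hx.1 n, ?_⟩
  cases n with
  | zero => exact hx.2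
  | succ n => exact betaMap_iterate_lt_one_of_pos β x (by omega)

theorem betaMap_iterate_le_pow_mul {β x : ℝ} (hβ : 1 < β) (hx : 0 ≤ x) (j : ℕ) :
    (betaMap β)^[j] x ≤ β ^ j * x := by
  induction j with
  | zero => simp
  | succ j ih =>
    rw [Function.iterate_succ_apply']
    calc _ ≤ β * (betaMap β)^[j] x := betaMap_le_mul hβ (betaMap_iterate_nonneg β hx j)
      _ ≤ β * (β ^ j * x) := by gcongr
      _ = _ := by ring

theorem betaMap_iterate_eq_pow_mul {β x : ℝ} (hβ : 1 < β) (hx : 0 ≤ x) {j : ℕ}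
    (h : β ^ j * x < 1) : (betaMap β)^[j] x = β ^ j * x := by
  induction j with
  | zero => simp
  | succ j ih =>
    have h' : β * (β ^ j * x) < 1 := by rwa [← mul_assoc, ← pow_succ']
    have h0 : 0 ≤ β ^ j * x := by positivity
    rw [Function.iterate_succ_apply', ih (by nlinarith), betaMap_eq_mul hβ h0 h', pow_succ']
    ring

theorem betaMap_iterate_eq_zero {β x : ℝ} {m n : ℕ} (hmn : m ≤ n)
    (h : (betaMap β)^[m] x = 0) : (betaMap β)^[n] x = 0 := by
  induction n, hmn using Nat.le_induction with
  | base => exact h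
  | succ n _ ih => rw [Function.iterate_succ_apply', ih]; simp [betaMap]

theorem pow_rpow_neg {β : ℝ} (hβ : 1 < β) (n : ℕ) (v : ℝ) :
    (β ^ n) ^ (-v) = β ^ (-(v * n)) := by
  rw [← Real.rpow_natCast, ← Real.rpow_mul (by linarith)]
  congr 1
  ring

/-! ### The exponents in terms of the orbit -/

theorem frequently_of_lt_betaExp {β x v : ℝ} (hβ : 1 < β) (h : (v : EReal) < betaExp β x) :
    ∃ᶠ n : ℕ in atTop, 1 ≤ n ∧ (betaMap β)^[n] x < β ^ (-(v * n)) := by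
  obtain ⟨_, ⟨w, hw, rfl⟩, hvw⟩ := lt_sSup_iff.1 h
  refine (Nat.frequently_atTop_iff_infinite.2 hw).mono fun n hn => ⟨hn.1, hn.2.trans_le ?_⟩
  rw [pow_rpow_neg hβ]
  have : v < w := EReal.coe_lt_coe_iff.1 hvw
  refine Real.rpow_le_rpow_of_exponent_le hβ.le ?_
  gcongr

theorem le_betaExp_of_frequently {β x v : ℝ} (hβ : 1 < β)
    (h : ∃ᶠ n : ℕ in atTop, 1 ≤ n ∧ (betaMap β)^[n] x < β ^ (-(v * n))) :
    (v : EReal) ≤ betaExp β x := by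
  refine le_sSup ⟨v, Nat.frequently_atTop_iff_infinite.1 (h.mono fun n hn => ?_), rfl⟩
  rwa [pow_rpow_neg hβ]

theorem eventually_of_betaExp_lt {β x v : ℝ} (hβ : 1 < β) (h : betaExp β x < v) :
    ∀ᶠ n : ℕ in atTop, β ^ (-(v * n)) ≤ (betaMap β)^[n] x := by
  by_contra hc
  refine absurd (le_betaExp_of_frequently hβ (v := v) ?_) (not_le.2 h)
  refine ((not_eventually.1 hc).and_eventually (eventually_ge_atTop 1)).mono fun n hn => ?_
  exact ⟨hn.2, not_le.1 hn.1⟩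

theorem betaExp_le_of_eventually {β x v : ℝ} (hβ : 1 < β)
    (h : ∀ᶠ n : ℕ in atTop, β ^ (-(v * n)) ≤ (betaMap β)^[n] x) : betaExp β x ≤ v := by
  by_contra hc
  obtain ⟨n, hn, hn'⟩ := ((frequently_of_lt_betaExp hβ (not_le.1 hc)).and_eventually h).exists
  exact absurd hn' (not_le.2 hn.2)

theorem eventually_of_lt_betaUniformExp {β x v : ℝ} (hβ : 1 < β)
    (h : (v : EReal) < betaUniformExp β x) :
    ∀ᶠ N : ℕ in atTop, ∃ n, 1 ≤ n ∧ n ≤ N ∧ (betaMap β)^[n] x < β ^ (-(v * N)) := by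
  obtain ⟨_, ⟨w, hw, rfl⟩, hvw⟩ := lt_sSup_iff.1 h
  refine Eventually.mono hw fun N ⟨n, h1, hn, hlt⟩ => ⟨n, h1, hn, hlt.trans_le ?_⟩
  rw [pow_rpow_neg hβ]
  have : v < w := EReal.coe_lt_coe_iff.1 hvw
  refine Real.rpow_le_rpow_of_exponent_le hβ.le ?_
  gcongr

theorem le_betaUniformExp_of_eventually {β x v : ℝ} (hβ : 1 < β)
    (h : ∀ᶠ N : ℕ in atTop, ∃ n, 1 ≤ n ∧ n ≤ N ∧ (betaMap β)^[n] x < β ^ (-(v * N))) :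
    (v : EReal) ≤ betaUniformExp β x := by
  refine le_sSup ⟨v, h.mono fun N ⟨n, h1, hn, hlt⟩ => ⟨n, h1, hn, ?_⟩, rfl⟩
  rwa [pow_rpow_neg hβ]

theorem betaUniformExp_le_of_frequently {β x v : ℝ} (hβ : 1 < β)
    (h : ∃ᶠ N : ℕ in atTop, ∀ n, 1 ≤ n → n ≤ N → β ^ (-(v * N)) ≤ (betaMap β)^[n] x) :
    betaUniformExp β x ≤ v := by
  by_contra hc
  obtain ⟨N, hN, n, h1, hn, hlt⟩ :=
    (h.and_eventually (eventually_of_lt_betaUniformExp hβ (not_le.1 hc))).exists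
  exact absurd (hN n h1 hn) (not_le.2 hlt)

theorem betaExp_eq_top_of_iterate_eq_zero {β x : ℝ} (hβ : 1 < β) {m : ℕ}
    (h : (betaMap β)^[m] x = 0) : betaExp β x = ⊤ := by
  refine (EReal.eq_top_iff_forall_lt _).2 fun y => ?_
  refine lt_of_lt_of_le (b := ((y + 1 : ℝ) : EReal)) (by exact_mod_cast lt_add_one y) ?_
  refine le_betaExp_of_frequently hβ (Eventually.frequently ?_)
  filter_upwards [eventually_ge_atTop m, eventually_ge_atTop 1] with n hn h1
  refine ⟨h1, ?_⟩
  rw [betaMap_iterate_eq_zero hn h]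
  exact Real.rpow_pos_of_pos (by linarith) _

/-- The orbit never hits `0`, as that would make the exponent infinite, so a constant absorbs the
finitely many exceptional times. It is a natural number so that countable unions over it are
available later. -/
theorem exists_forall_rpow_le_iterate {β x v : ℝ} (hβ : 1 < β) (hx : 0 ≤ x)
    (h : betaExp β x < v) :
    ∃ c : ℕ, ∀ n : ℕ, β ^ (-(v * n + c)) ≤ (betaMap β)^[n] x := by
  have hpos : ∀ n, 0 < (betaMap β)^[n] x := fun n =>
    (betaMap_iterate_nonneg β hx n).lt_of_ne' fun h0 => by
      rw [betaExp_eq_top_of_iterate_eq_zero hβ h0] at h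
      exact not_top_lt h
  have hβ0 : 0 < β := by linarith
  obtain ⟨n₀, hn₀⟩ := eventually_atTop.1 (eventually_of_betaExp_lt hβ h)
  have hex : ∀ n : ℕ, ∃ c : ℕ, β ^ (-(v * n + c)) ≤ (betaMap β)^[n] x := fun n => by
    obtain ⟨c, hc⟩ := exists_nat_ge (-(v * n) - Real.logb β ((betaMap β)^[n] x))
    refine ⟨c, (Real.le_logb_iff_rpow_le hβ (hpos n)).1 (by linarith)⟩
  choose c hc using hex
  refine ⟨(Finset.range n₀).sup c, fun n => ?_⟩
  by_cases hn : n < n₀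
  · refine le_trans (Real.rpow_le_rpow_of_exponent_le hβ.le ?_) (hc n)
    have : c n ≤ (Finset.range n₀).sup c := Finset.le_sup (Finset.mem_range.2 hn)
    have : (c n : ℝ) ≤ ((Finset.range n₀).sup c : ℕ) := by exact_mod_cast this
    linarith
  · refine le_trans (Real.rpow_le_rpow_of_exponent_le hβ.le ?_) (hn₀ n (not_lt.1 hn))
    have : (0 : ℝ) ≤ ((Finset.range n₀).sup c : ℕ) := by positivity
    linarith

/-! ### Record times of the orbit -/

/-- `n` is a time at which the orbit of `x` comes closer to `0` than at all earlier positive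
times. -/
def IsRecordTime (β x : ℝ) (n : ℕ) : Prop :=
  1 ≤ n ∧ ∀ j, 1 ≤ j → j < n → (betaMap β)^[n] x < (betaMap β)^[j] x

/-- The first minimiser over the positive times up to `n` works: the induction changes `r` only at a
strict decrease. -/
theorem exists_isRecordTime_le (β x : ℝ) {n : ℕ} (hn : 1 ≤ n) :
    ∃ r ≤ n, IsRecordTime β x r ∧
      ∀ j, 1 ≤ j → j ≤ n → (betaMap β)^[r] x ≤ (betaMap β)^[j] x := by
  induction n, hn using Nat.le_induction with
  | base =>
    refine ⟨1, le_rfl, ⟨le_rfl, fun j h1 h2 => by omega⟩, fun j h1 h2 => ?_⟩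
    rw [show j = 1 by omega]
  | succ n hn ih =>
    obtain ⟨r, hrn, hr, hmin⟩ := ih
    by_cases hlt : (betaMap β)^[n + 1] x < (betaMap β)^[r] x
    · refine ⟨n + 1, le_rfl, ⟨by omega, fun j h1 h2 => ?_⟩, fun j h1 h2 => ?_⟩
      · exact hlt.trans_le (hmin j h1 (by omega))
      · rcases Nat.lt_or_ge j (n + 1) with h | h
        · exact hlt.le.trans (hmin j h1 (by omega))
        · rw [show j = n + 1 by omega]
    · refine ⟨r, by omega, hr, fun j h1 h2 => ?_⟩
      rcases Nat.lt_or_ge j (n + 1) with h | h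
      · exact hmin j h1 (by omega)
      · rw [show j = n + 1 by omega]; exact not_lt.1 hlt

/-- Otherwise the orbit would only be multiplied by `β` between `r` and `n`, and could not be
smaller at `n` than at `r`. -/
theorem IsRecordTime.one_le_pow_mul {β x : ℝ} (hβ : 1 < β) (hx : 0 ≤ x) {r n : ℕ}
    (hn : IsRecordTime β x n) (hr : 1 ≤ r) (hrn : r < n) :
    1 ≤ β ^ (n - r) * (betaMap β)^[r] x := by
  by_contra hc
  have h0 := betaMap_iterate_nonneg β hx r
  have h := betaMap_iterate_eq_pow_mul hβ h0 (not_le.1 hc)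
  rw [← Function.iterate_add_apply, Nat.sub_add_cancel hrn.le] at h
  have h1 := hn.2 r hr hrn
  have h2 : 1 ≤ β ^ (n - r) := one_le_pow₀ hβ.le
  nlinarith

theorem IsRecordTime.exists_previous {β x w : ℝ} (hβ : 1 < β) (hx : 0 ≤ x) {n : ℕ}
    (hn : IsRecordTime β x n) (h2 : 2 ≤ n)
    (h : ∃ m, 1 ≤ m ∧ m ≤ n - 1 ∧ (betaMap β)^[m] x < β ^ (-(w * (n - 1 : ℕ)))) :
    ∃ r, IsRecordTime β x r ∧ r < n ∧ (betaMap β)^[r] x < β ^ (-(w * (n - 1 : ℕ))) ∧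
      r + w * (n - 1 : ℕ) < n := by
  obtain ⟨m, hm1, hmn, hm⟩ := h
  obtain ⟨r, hrn, hr, hmin⟩ := exists_isRecordTime_le β x (n := n - 1) (by omega)
  have hlt := (hmin m hm1 hmn).trans_lt hm
  refine ⟨r, hr, by omega, hlt, ?_⟩
  have h1 := hn.one_le_pow_mul hβ hx hr.1 (show r < n by omega)
  have hβ0 : 0 < β := by linarith
  have h3 : (1 : ℝ) < β ^ ((n : ℝ) - r + -(w * (n - 1 : ℕ))) := by
    rw [Real.rpow_add hβ0, ← Nat.cast_sub (by omega : r ≤ n), Real.rpow_natCast]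
    exact h1.trans_lt (by gcongr)
  have h4 := (Real.one_lt_rpow_iff_of_pos hβ0).1 h3
  rcases h4 with h4 | h4
  · linarith [h4.2]
  · linarith

/-- A value below all of the first `m + 1` iterates pushes the first minimiser up to `n` beyond `m`.
The property `p` is known only at `n`, so both times are returned. -/
theorem exists_isRecordTime_ge {β x : ℝ} (hpos : ∀ n, 0 < (betaMap β)^[n] x) {p : ℕ → Prop}
    (h : ∀ δ > 0, ∃ n, 1 ≤ n ∧ p n ∧ (betaMap β)^[n] x < δ) (m : ℕ) :
    ∃ r n, m ≤ r ∧ r ≤ n ∧ p n ∧ IsRecordTime β x r ∧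
      (betaMap β)^[r] x ≤ (betaMap β)^[n] x := by
  obtain ⟨j, -, hj⟩ := (Finset.range (m + 1)).exists_min_image (fun j => (betaMap β)^[j] x)
    ⟨0, by simp⟩
  obtain ⟨n, h1, hp, hlt⟩ := h _ (hpos j)
  obtain ⟨r, hrn, hr, hmin⟩ := exists_isRecordTime_le β x h1
  have hrn' := hmin n h1 le_rfl
  refine ⟨r, n, ?_, hrn, hp, hr, hrn'⟩
  by_contra hc
  exact absurd (hj r (by simp; omega)) (not_le.2 (hrn'.trans_lt hlt))

theorem tendsto_rpow_neg_mul_atTop {β w : ℝ} (hβ : 1 < β) (hw : 0 < w) :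
    Tendsto (fun n : ℕ => β ^ (-(w * n))) atTop (nhds 0) := by
  have h : (fun n : ℕ => β ^ (-(w * n))) = fun n : ℕ => (β ^ (-w)) ^ n := by
    ext n
    rw [← Real.rpow_mul_natCast (by linarith), neg_mul]
  rw [h]
  exact tendsto_pow_atTop_nhds_zero_of_lt_one (by positivity)
    (Real.rpow_lt_one_of_one_lt_of_neg hβ (by linarith))

/-- The classical inequality `v_β ≥ v̂_β / (1 - v̂_β)`, for points with infinite expansion. -/
theorem div_one_sub_le_of_betaExp_lt {β x v u : ℝ} (hβ : 1 < β) (hx : 0 ≤ x)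
    (hv : 0 < v) (hv1 : v < 1) (h : (v : EReal) ≤ betaUniformExp β x) (hu : betaExp β x < u) : v / (1 - v) ≤ u := by
  by_contra! hlt
  have hpos : ∀ n, 0 < (betaMap β)^[n] x := fun n =>
    (betaMap_iterate_nonneg β hx n).lt_of_ne' fun h0 => by
      rw [betaExp_eq_top_of_iterate_eq_zero hβ h0] at hu
      exact not_top_lt hu
  rw [lt_div_iff₀ (by linarith)] at hlt
  -- The negated inequality is open in `v`, so it survives a decrease to some `w` below the uniform
  -- exponent.
  obtain ⟨w, hw0, hwv, hw⟩ : ∃ w, 0 < w ∧ w < v ∧ u * (1 - w) < w := by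
    have hc : ContinuousAt (fun w : ℝ => w - u * (1 - w)) v := by fun_prop
    have h1 : ∀ᶠ w in nhds v, 0 < w - u * (1 - w) :=
      hc.eventually (lt_mem_nhds (by linarith))
    have h2 := (h1.and (lt_mem_nhds hv)).filter_mono (nhdsWithin_le_nhds (s := Iio v))
    obtain ⟨w, ⟨h3, h4⟩, h5⟩ := (h2.and self_mem_nhdsWithin).exists
    exact ⟨w, h4, h5, by linarith⟩
  obtain ⟨c, hc⟩ := exists_forall_rpow_le_iterate hβ hx hu
  have hunif := eventually_of_lt_betaUniformExp hβ
    (lt_of_lt_of_le (EReal.coe_lt_coe_iff.2 hwv) h)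
  obtain ⟨N₀, hN₀⟩ := eventually_atTop.1 hunif
  -- A record time `n` will satisfy `(n - 1)(w - u(1 - w)) < u + c`, which fails once `n > k`.
  obtain ⟨k, hk⟩ := exists_nat_gt ((u + c) / (w - u * (1 - w)))
  have hu0 : 0 ≤ u := by
    by_contra! hneg
    have : Tendsto (fun n : ℕ => -(u * n + c)) atTop atTop := by
      have h1 : Tendsto (fun n : ℕ => (-u) * (n : ℝ) + (-c : ℝ)) atTop atTop :=
        tendsto_atTop_add_const_right _ _
          (tendsto_natCast_atTop_atTop.const_mul_atTop (by linarith))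
      refine h1.congr fun n => by ring
    obtain ⟨n, hn, h1⟩ := ((this.eventually_ge_atTop 0).and (eventually_ge_atTop 1)).exists
    have := (Real.one_le_rpow hβ.le hn).trans (hc n)
    linarith [betaMap_iterate_lt_one_of_pos β x h1]
  obtain ⟨n, _, hn, -, -, hrec, -⟩ := exists_isRecordTime_ge hpos (p := fun _ => True)
    (fun δ hδ => by
      obtain ⟨N, ⟨n, h1, h2, h3⟩, h4⟩ := (hunif.and
        ((tendsto_rpow_neg_mul_atTop hβ hw0).eventually (gt_mem_nhds hδ))).exists
      exact ⟨n, h1, trivial, h3.trans h4⟩) (N₀ + k + 2)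
  obtain ⟨r, hr, -, hlt', hadd⟩ := hrec.exists_previous (w := w) hβ hx (by omega)
    (hN₀ (n - 1) (by omega))
  have h1 := (Real.rpow_lt_rpow_left_iff hβ).1 ((hc r).trans_lt hlt')
  have h2 : ((n - 1 : ℕ) : ℝ) = n - 1 := by
    rw [Nat.cast_sub (by omega)]; simp
  have h3 : (k : ℝ) + 1 ≤ n := by exact_mod_cast (by omega : k + 1 ≤ n)
  rw [div_lt_iff₀ (by linarith)] at hk
  rw [h2] at h1 hadd
  have h4 : u * r ≤ u * (n - w * (n - 1)) := mul_le_mul_of_nonneg_left (by linarith) hu0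
  have h5 : (k : ℝ) * (w - u * (1 - w)) ≤ (n - 1) * (w - u * (1 - w)) :=
    mul_le_mul_of_nonneg_right (by linarith) (by linarith)
  nlinarith

/-! ### Full cylinders -/

/-- The left end points of the full cylinders of order `n`, that is, of the intervals
`[a, a + β ^ (-n))` in `[0, 1]` which `T_β ^ n` maps affinely onto `[0, 1)`. -/
def fullOffsets (β : ℝ) (n : ℕ) : Set ℝ :=
  {a | 0 ≤ a ∧ a + (β ^ n)⁻¹ ≤ 1 ∧
    ∀ y ∈ Ico (0 : ℝ) 1, (betaMap β)^[n] (a + (β ^ n)⁻¹ * y) = y}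

theorem zero_mem_fullOffsets_zero (β : ℝ) : 0 ∈ fullOffsets β 0 := by
  simp [fullOffsets]

/-- Appending the digit `0` to a full word gives a full word with the same left end point. -/
theorem fullOffsets_subset_succ {β : ℝ} (hβ : 1 < β) (n : ℕ) :
    fullOffsets β n ⊆ fullOffsets β (n + 1) := by
  rintro a ⟨h0, h1, h⟩
  have hβ0 : 0 < β := by linarith
  have hp : (0 : ℝ) < β ^ n := by positivity
  have hle : (β ^ (n + 1))⁻¹ ≤ (β ^ n)⁻¹ := by gcongr; exacts [hβ.le, by omega]
  refine ⟨h0, by linarith, fun y hy => ?_⟩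
  have hy' : β⁻¹ * y < 1 := by
    have := inv_lt_one_of_one_lt₀ hβ
    nlinarith [hy.1, hy.2, inv_pos.2 hβ0]
  have h2 := h (β⁻¹ * y) ⟨by have := hy.1; positivity, hy'⟩
  rw [show (β ^ (n + 1))⁻¹ * y = (β ^ n)⁻¹ * (β⁻¹ * y) by rw [pow_succ, mul_inv]; ring,
    Function.iterate_succ_apply', h2, betaMap_eq_fract, mul_inv_cancel_left₀ hβ0.ne']
  exact Int.fract_eq_self.2 hy

theorem fullOffsets_mono {β : ℝ} (hβ : 1 < β) : Monotone (fullOffsets β) :=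
  monotone_nat_of_le_succ (fullOffsets_subset_succ hβ)

/-- If `b` lay in the cylinder starting at `a`, then `T^n b` would be both `β^n (b - a) > 0` and
`0`. -/
theorem fullOffsets_separated {β : ℝ} (hβ : 1 < β) {n : ℕ} {a b : ℝ}
    (ha : a ∈ fullOffsets β n) (hb : b ∈ fullOffsets β n) (hab : a < b) :
    (β ^ n)⁻¹ ≤ b - a := by
  by_contra! hlt
  have hβ0 : 0 < β := by linarith
  have hp : (0 : ℝ) < β ^ n := by positivity
  have h1 : β ^ n * (b - a) < 1 := by
    have := mul_lt_mul_of_pos_left hlt hp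
    rwa [mul_inv_cancel₀ hp.ne'] at this
  have h2 := ha.2.2 (β ^ n * (b - a)) ⟨by nlinarith, h1⟩
  have h3 := hb.2.2 0 (by simp)
  rw [inv_mul_cancel_left₀ hp.ne', add_sub_cancel] at h2
  rw [mul_zero, add_zero, h2] at h3
  nlinarith

theorem fullOffsets_finite_and_ncard_le {β : ℝ} (hβ : 1 < β) (n : ℕ) :
    (fullOffsets β n).Finite ∧ ((fullOffsets β n).ncard : ℝ) ≤ β ^ n := by
  have hβ0 : 0 < β := by linarith
  have hp : (0 : ℝ) < β ^ n := by positivity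
  have hmaps : ∀ a ∈ fullOffsets β n, ⌊β ^ n * a⌋₊ ∈ (Finset.range ⌊β ^ n⌋₊ : Set ℕ) := by
    intro a ha
    have h1 := mul_le_mul_of_nonneg_left ha.2.1 hp.le
    rw [mul_add, mul_inv_cancel₀ hp.ne', mul_one] at h1
    have h0 : 0 ≤ β ^ n * a := mul_nonneg hp.le ha.1
    simp only [Finset.coe_range, mem_Iio]
    rw [← Nat.succ_le_iff, Nat.succ_eq_add_one, ← Nat.floor_add_one h0]
    exact Nat.floor_le_floor h1
  have hlt : ∀ a ∈ fullOffsets β n, ∀ b ∈ fullOffsets β n, a < b →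
      ⌊β ^ n * a⌋₊ ≠ ⌊β ^ n * b⌋₊ := by
    intro a ha b hb hab
    have h1 := mul_le_mul_of_nonneg_left (fullOffsets_separated hβ ha hb hab) hp.le
    rw [mul_inv_cancel₀ hp.ne', mul_sub] at h1
    have h0 : 0 ≤ β ^ n * a := mul_nonneg hp.le ha.1
    have h2 : ⌊β ^ n * a + 1⌋₊ ≤ ⌊β ^ n * b⌋₊ := Nat.floor_le_floor (by linarith)
    rw [Nat.floor_add_one h0] at h2
    omega
  have hinj : InjOn (fun a => ⌊β ^ n * a⌋₊) (fullOffsets β n) := by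
    intro a ha b hb hab
    rcases lt_trichotomy a b with h | h | h
    · exact absurd hab (hlt a ha b hb h)
    · exact h
    · exact absurd hab.symm (hlt b hb a ha h)
  refine ⟨Finite.of_injOn hmaps hinj (Finset.finite_toSet _), ?_⟩
  have h1 := ncard_le_ncard_of_injOn _ hmaps hinj (Finset.finite_toSet _)
  rw [ncard_coe_finset, Finset.card_range] at h1
  exact (Nat.cast_le.2 h1).trans (Nat.floor_le hp.le)

/-! ### Left end points of all cylinders -/

/-- The left end points of the cylinders of order `n`. -/
def leftEndpoints (β : ℝ) (n : ℕ) : Set ℝ :=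
  (fun y => y - (β ^ n)⁻¹ * (betaMap β)^[n] y) '' Ico 0 1

/-- The lengths, multiplied by `β ^ m`, of the rightmost cylinders of order `m` in `[0, 1)`. -/
noncomputable def lastLength (β : ℝ) : ℕ → ℝ
  | 0 => 1
  | m + 1 => β * lastLength β m - (⌈β * lastLength β m⌉ - 1)

/-- The last digit is `⌈·⌉ - 1` and not a floor: cylinders are half-open, so an integral `β *
lastLength β m` must leave length `1`, not an empty cylinder. -/
theorem lastLength_mem (β : ℝ) (m : ℕ) : lastLength β m ∈ Ioc (0 : ℝ) 1 := by
  cases m with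
  | zero => simp [lastLength]
  | succ m =>
    have h1 := Int.ceil_lt_add_one (β * lastLength β m)
    have h2 := Int.le_ceil (β * lastLength β m)
    constructor <;> simp only [lastLength] <;> linarith

theorem betaMap_iterate_last {β : ℝ} (hβ : 1 < β) (m : ℕ) {z : ℝ}
    (hz : z ∈ Ico 0 (lastLength β m)) :
    (betaMap β)^[m] (1 - (β ^ m)⁻¹ * lastLength β m + (β ^ m)⁻¹ * z) = z := by
  have hβ0 : 0 < β := by linarith
  induction m generalizing z with
  | zero => simp [lastLength]
  | succ m ih =>
    set c : ℤ := ⌈β * lastLength β m⌉ - 1 with hc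
    have ht : lastLength β (m + 1) = β * lastLength β m - c := by simp [lastLength, hc]
    have hcn : (0 : ℝ) ≤ c := by
      have : 0 < ⌈β * lastLength β m⌉ := Int.ceil_pos.2 (mul_pos hβ0 (lastLength_mem β m).1)
      exact_mod_cast (by omega : 0 ≤ c)
    have hz1 : z < 1 := hz.2.trans_le (lastLength_mem β (m + 1)).2
    have hz2 := hz.2
    rw [ht] at hz2
    have key := ih (z := β⁻¹ * (c + z)) ⟨by have := hz.1; positivity, by
      rw [inv_mul_lt_iff₀ hβ0]; linarith⟩
    have harg : 1 - (β ^ (m + 1))⁻¹ * lastLength β (m + 1) + (β ^ (m + 1))⁻¹ * z =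
        1 - (β ^ m)⁻¹ * lastLength β m + (β ^ m)⁻¹ * (β⁻¹ * (c + z)) := by
      rw [ht, pow_succ]
      field_simp
      ring
    rw [harg, Function.iterate_succ_apply', key, betaMap_eq_fract, mul_inv_cancel_left₀ hβ0.ne',
      Int.fract_intCast_add]
    exact Int.fract_eq_self.2 ⟨hz.1, hz1⟩

/-- Every point lies in a cylinder which is a full cylinder of order `k` followed by a rightmost
cylinder of order `n - k`. -/
theorem exists_fullOffsets_add_last {β : ℝ} (hβ : 1 < β) (n : ℕ) {x : ℝ}
    (hx : x ∈ Ico (0 : ℝ) 1) :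
    ∃ k m, k + m = n ∧ ∃ a ∈ fullOffsets β k, ∃ z ∈ Ico 0 (lastLength β m),
      x = a + (β ^ k)⁻¹ * (1 - (β ^ m)⁻¹ * lastLength β m + (β ^ m)⁻¹ * z) := by
  have hβ0 : 0 < β := by linarith
  induction n with
  | zero =>
    exact ⟨0, 0, rfl, 0, zero_mem_fullOffsets_zero β, x, by simpa [lastLength] using hx,
      by simp [lastLength]⟩
  | succ n ih =>
    obtain ⟨k, m, hkm, a, ha, z, hz, hxz⟩ := ih
    set c : ℤ := ⌈β * lastLength β m⌉ - 1 with hc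
    have ht : lastLength β (m + 1) = β * lastLength β m - c := by simp [lastLength, hc]
    -- If the next digit is the largest admissible one, `c`, the rightmost cylinder is prolonged. A
    -- smaller digit has a complete branch, so the whole word becomes full and the rightmost part
    -- restarts at order `0`.
    by_cases hcz : (c : ℝ) ≤ β * z
    · refine ⟨k, m + 1, by omega, a, ha, β * z - c, ⟨by linarith, ?_⟩, ?_⟩
      · rw [ht]
        have := mul_lt_mul_of_pos_left hz.2 hβ0
        linarith
      · rw [hxz, ht, pow_succ]
        field_simp
        ring
    · have hfl : ⌊β * z⌋ + 1 ≤ c := by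
        have : ⌊β * z⌋ < c := Int.floor_lt.2 (not_le.1 hcz)
        omega
      have hfl' : (⌊β * z⌋ : ℝ) + 1 ≤ c := by exact_mod_cast hfl
      have hfl0 : (0 : ℝ) ≤ ⌊β * z⌋ := by
        exact_mod_cast Int.floor_nonneg.2 (mul_nonneg hβ0.le hz.1)
      have hcl : (c : ℝ) < β * lastLength β m := by
        have := (lastLength_mem β (m + 1)).1
        rw [ht] at this
        linarith
      have hl := lastLength_mem β m
      have hbase : 0 ≤ 1 - (β ^ m)⁻¹ * lastLength β m := by
        have : (β ^ m)⁻¹ ≤ 1 := inv_le_one_of_one_le₀ (one_le_pow₀ hβ.le)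
        have h0 : 0 ≤ (β ^ m)⁻¹ := by positivity
        nlinarith [hl.1, hl.2]
      have hpk : (0 : ℝ) ≤ (β ^ k)⁻¹ := by positivity
      have hpm : (0 : ℝ) < (β ^ m)⁻¹ := by positivity
      have hin : ∀ y ∈ Ico (0 : ℝ) 1, β⁻¹ * (⌊β * z⌋ + y) ∈ Ico 0 (lastLength β m) := by
        intro y hy
        refine ⟨by have := hy.1; positivity, ?_⟩
        rw [inv_mul_lt_iff₀ hβ0]
        linarith [hy.2]
      refine ⟨n + 1, 0, rfl, a + (β ^ k)⁻¹ * (1 - (β ^ m)⁻¹ * lastLength β m +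
        (β ^ m)⁻¹ * (β⁻¹ * ⌊β * z⌋)), ⟨?_, ?_, ?_⟩, Int.fract (β * z), ?_, ?_⟩
      · have := ha.1
        positivity
      · have h1 : β⁻¹ * (⌊β * z⌋ + 1) ≤ lastLength β m := by
          rw [inv_mul_le_iff₀ hβ0]
          linarith
        have h2 : 1 - (β ^ m)⁻¹ * lastLength β m + (β ^ m)⁻¹ * (β⁻¹ * (⌊β * z⌋ + 1)) ≤ 1 := by
          have := mul_le_mul_of_nonneg_left h1 hpm.le
          linarith
        calc _ = a + (β ^ k)⁻¹ * (1 - (β ^ m)⁻¹ * lastLength β m +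
              (β ^ m)⁻¹ * (β⁻¹ * (⌊β * z⌋ + 1))) := by
              rw [← hkm, pow_succ, pow_add]
              field_simp
              ring
          _ ≤ a + (β ^ k)⁻¹ * 1 := by gcongr
          _ ≤ 1 := by rw [mul_one]; exact ha.2.1
      · intro y hy
        have hz' := hin y hy
        have hlt : 1 - (β ^ m)⁻¹ * lastLength β m + (β ^ m)⁻¹ * (β⁻¹ * (⌊β * z⌋ + y)) < 1 := by
          have := mul_lt_mul_of_pos_left hz'.2 hpm
          linarith
        have harg : a + (β ^ k)⁻¹ * (1 - (β ^ m)⁻¹ * lastLength β m +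
            (β ^ m)⁻¹ * (β⁻¹ * ⌊β * z⌋)) + (β ^ (n + 1))⁻¹ * y = a + (β ^ k)⁻¹ *
            (1 - (β ^ m)⁻¹ * lastLength β m + (β ^ m)⁻¹ * (β⁻¹ * (⌊β * z⌋ + y))) := by
          rw [← hkm, pow_succ, pow_add]
          field_simp
          ring
        rw [harg, Function.iterate_succ_apply', ← hkm, add_comm k m, Function.iterate_add_apply,
          ha.2.2 _ ⟨by have := hz'.1; positivity, hlt⟩, betaMap_iterate_last hβ m hz',
          betaMap_eq_fract, mul_inv_cancel_left₀ hβ0.ne', Int.fract_intCast_add]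
        exact Int.fract_eq_self.2 hy
      · simp only [lastLength, mem_Ico]
        exact ⟨Int.fract_nonneg _, Int.fract_lt_one _⟩
      · have h := Int.floor_add_fract (β * z)
        rw [hxz]
        have h3 : z = β⁻¹ * (⌊β * z⌋ + Int.fract (β * z)) := by
          rw [h, inv_mul_cancel_left₀ hβ0.ne']
        conv_lhs => rw [h3]
        rw [← hkm, pow_succ, pow_add, lastLength]
        field_simp
        ring

/-- In the decomposition of a point, `z = T^n x` cancels from the left end point, leaving only `k`
and the full offset. -/
theorem leftEndpoints_subset {β : ℝ} (hβ : 1 < β) (n : ℕ) :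
    leftEndpoints β n ⊆ ⋃ k ∈ Finset.range (n + 1),
      (fun a => a + (β ^ k)⁻¹ * (1 - (β ^ (n - k))⁻¹ * lastLength β (n - k))) ''
        fullOffsets β k := by
  rintro _ ⟨x, hx, rfl⟩
  have hβ0 : 0 < β := by linarith
  obtain ⟨k, m, rfl, a, ha, z, hz, hxz⟩ := exists_fullOffsets_add_last hβ n hx
  simp only [mem_iUnion, Finset.mem_range]
  refine ⟨k, by omega, a, ha, ?_⟩
  have hpm : (0 : ℝ) < (β ^ m)⁻¹ := by positivity
  have hl := lastLength_mem β m
  have hbase : 0 ≤ 1 - (β ^ m)⁻¹ * lastLength β m := by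
    have : (β ^ m)⁻¹ ≤ 1 := inv_le_one_of_one_le₀ (one_le_pow₀ hβ.le)
    nlinarith [hl.1, hl.2]
  have hT : (betaMap β)^[k + m] x = z := by
    rw [hxz, add_comm k m, Function.iterate_add_apply, ha.2.2 _ ⟨?_, ?_⟩,
      betaMap_iterate_last hβ m hz]
    · have := hz.1
      positivity
    · have := mul_lt_mul_of_pos_left hz.2 hpm
      linarith
  simp only [Nat.add_sub_cancel_left]
  rw [hT, hxz, pow_add]
  field_simp
  ring

theorem ncard_biUnion_image_le {ι α γ : Type*} (s : Finset ι) (A : ι → Set α) (f : ι → α → γ)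
    (hA : ∀ i ∈ s, (A i).Finite) :
    (⋃ i ∈ s, f i '' A i).Finite ∧ (⋃ i ∈ s, f i '' A i).ncard ≤ ∑ i ∈ s, (A i).ncard := by
  refine ⟨s.finite_toSet.biUnion fun i hi => (hA i hi).image _, ?_⟩
  refine (Finset.set_ncard_biUnion_le s _).trans (Finset.sum_le_sum fun i hi => ?_)
  exact ncard_image_le (hA i hi)

theorem leftEndpoints_finite {β : ℝ} (hβ : 1 < β) (n : ℕ) : (leftEndpoints β n).Finite :=
  (ncard_biUnion_image_le _ _ _
    fun k _ => (fullOffsets_finite_and_ncard_le hβ k).1).1.subset (leftEndpoints_subset hβ n)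

theorem ncard_leftEndpoints_le_sum {β : ℝ} (hβ : 1 < β) (n : ℕ) :
    (leftEndpoints β n).ncard ≤ ∑ k ∈ Finset.range (n + 1), (fullOffsets β k).ncard := by
  have h := ncard_biUnion_image_le (Finset.range (n + 1)) (fullOffsets β)
    (fun k a => a + (β ^ k)⁻¹ * (1 - (β ^ (n - k))⁻¹ * lastLength β (n - k)))
    fun k _ => (fullOffsets_finite_and_ncard_le hβ k).1
  exact (ncard_le_ncard (leftEndpoints_subset hβ n) h.1).trans h.2

/-- Rényi's upper bound for the number of cylinders. -/
theorem ncard_leftEndpoints_le {β : ℝ} (hβ : 1 < β) (n : ℕ) :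
    ((leftEndpoints β n).ncard : ℝ) ≤ β / (β - 1) * β ^ n := by
  have h1 : ((leftEndpoints β n).ncard : ℝ) ≤ ∑ k ∈ Finset.range (n + 1), β ^ k := by
    refine (Nat.cast_le.2 (ncard_leftEndpoints_le_sum hβ n)).trans ?_
    push_cast
    exact Finset.sum_le_sum fun k _ => (fullOffsets_finite_and_ncard_le hβ k).2
  refine h1.trans ?_
  have hb : 0 < β - 1 := by linarith
  rw [geom_sum_eq hβ.ne', div_mul_eq_mul_div]
  gcongr
  rw [pow_succ']
  linarith

/-- Cylinders of order `n` cover `[0, 1)` and have length at most `β^(-n)`; compare Lebesgue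
measures. -/
theorem pow_le_ncard_leftEndpoints {β : ℝ} (hβ : 1 < β) (n : ℕ) :
    β ^ n ≤ (leftEndpoints β n).ncard := by
  have hβ0 : 0 < β := by linarith
  have hp : (0 : ℝ) < β ^ n := by positivity
  have hfin := leftEndpoints_finite hβ n
  have hsub : Ico (0 : ℝ) 1 ⊆ ⋃ a ∈ hfin.toFinset, Ico a (a + (β ^ n)⁻¹) := by
    intro x hx
    have hT := betaMap_iterate_mem_Ico β hx n
    have hpi : (0 : ℝ) < (β ^ n)⁻¹ := by positivity
    simp only [mem_iUnion, Finite.mem_toFinset]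
    refine ⟨_, ⟨x, hx, rfl⟩, ?_, ?_⟩
    · have := mul_nonneg hpi.le hT.1
      linarith
    · have := mul_lt_mul_of_pos_left hT.2 hpi
      linarith
  have h1 := (MeasureTheory.measure_mono (μ := MeasureTheory.volume) hsub).trans
    (MeasureTheory.measure_biUnion_finset_le _ _)
  simp only [Real.volume_Ico, add_sub_cancel_left, sub_zero, Finset.sum_const, nsmul_eq_mul,
    ENNReal.ofReal_one] at h1
  rw [← ncard_eq_toFinset_card _ hfin, ← ENNReal.ofReal_natCast,
    ← ENNReal.ofReal_mul (by positivity), ENNReal.one_le_ofReal, ← div_eq_mul_inv, one_le_div hp] at h1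
  exact h1

/-- By monotonicity each of the `n + 1` terms bounding the number of cylinders is at most the last
one. The polynomial loss does not affect exponential rates. -/
theorem pow_le_ncard_fullOffsets {β : ℝ} (hβ : 1 < β) (n : ℕ) :
    β ^ n ≤ (n + 1) * (fullOffsets β n).ncard := by
  refine (pow_le_ncard_leftEndpoints hβ n).trans ?_
  have h : (leftEndpoints β n).ncard ≤ (n + 1) * (fullOffsets β n).ncard := by
    refine (ncard_leftEndpoints_le_sum hβ n).trans ?_
    refine (Finset.sum_le_card_nsmul _ _ (fullOffsets β n).ncard fun k hk => ?_).trans (by simp)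
    exact ncard_le_ncard (fullOffsets_mono hβ (by simp at hk; omega))
      (fullOffsets_finite_and_ncard_le hβ n).1
  exact_mod_cast h

/-! ### A covering bound for Hausdorff dimension -/

open MeasureTheory in
-- The intervals of all generations beyond `N` cover `E`, and their `s`-sums are tails of a
-- convergent geometric series. Only finiteness of the Hausdorff measure is needed, so the full
-- series serves as the bound.
theorem dimH_le_of_frequently_mem_Icc {E : Set ℝ} {A : ℕ → Set ℝ} {β K τ u s : ℝ} (hβ : 1 < β)
    (hA : ∀ n, (A n).Finite) (hcard : ∀ n, ((A n).ncard : ℝ) ≤ K * β ^ (τ * n)) (hs : 0 ≤ s)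
    (hu : 0 < u) (hτ : τ < s * u)
    (hE : ∀ x ∈ E, ∃ᶠ n : ℕ in atTop, ∃ a ∈ A n, x ∈ Icc a (a + β ^ (-(u * n)))) :
    dimH E ≤ ENNReal.ofReal s := by
  have hβ0 : 0 < β := by linarith
  refine dimH_le_of_hausdorffMeasure_ne_top (d := s.toNNReal) ?_
  rw [Real.coe_toNNReal s hs]
  set f : ℕ → ENNReal := fun n => ENNReal.ofReal (K * β ^ (-((s * u - τ) * n))) with hf
  have hfsum : ∑' n, f n ≠ ⊤ := by
    refine Summable.tsum_ofReal_ne_top (Summable.mul_left K ?_)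
    have h : (fun n : ℕ => β ^ (-((s * u - τ) * n))) = fun n : ℕ => (β ^ (-(s * u - τ))) ^ n := by
      ext n
      rw [← Real.rpow_mul_natCast hβ0.le, neg_mul]
    rw [h]
    exact summable_geometric_of_lt_one (by positivity)
      (Real.rpow_lt_one_of_one_lt_of_neg hβ (by linarith))
  have : ∀ n, Countable (A n) := fun n => (hA n).countable
  have hdiam : ∀ (a : ℝ) (n : ℕ), Metric.ediam (Icc a (a + β ^ (-(u * n)))) =
      ENNReal.ofReal (β ^ (-(u * n))) := fun a n => by
    rw [Real.ediam_Icc, add_sub_cancel_left]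
  have hmono : ∀ m n : ℕ, m ≤ n → β ^ (-(u * n)) ≤ β ^ (-(u * m)) := fun m n h =>
    Real.rpow_le_rpow_of_exponent_le hβ.le (by
      have : (m : ℝ) ≤ n := by exact_mod_cast h
      nlinarith)
  have hle := Measure.hausdorffMeasure_le_liminf_tsum (β := ℕ) (ι := fun N => Σ n, A (n + N)) s E
    (l := atTop) (fun N => ENNReal.ofReal (β ^ (-(u * N))))
    (by simpa using ENNReal.tendsto_ofReal (tendsto_rpow_neg_mul_atTop hβ hu))
    (fun N i => Icc i.2.1 (i.2.1 + β ^ (-(u * (i.1 + N : ℕ)))))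
    (Eventually.of_forall fun N i => by
      rw [hdiam]
      exact ENNReal.ofReal_le_ofReal (hmono _ _ (by omega)))
    (Eventually.of_forall fun N x hx => by
      obtain ⟨n, ⟨a, ha, hxa⟩, hn⟩ := ((hE x hx).and_eventually (eventually_ge_atTop N)).exists
      obtain ⟨m, rfl⟩ := Nat.exists_eq_add_of_le' hn
      exact mem_iUnion.2 ⟨⟨m, a, ha⟩, hxa⟩)
  refine ne_top_of_le_ne_top hfsum (hle.trans ?_)
  refine liminf_le_of_le (by isBoundedDefault) fun b hb => ?_
  obtain ⟨N, hN⟩ := hb.exists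
  refine hN.trans ?_
  rw [ENNReal.tsum_sigma']
  have hterm : ∀ n, ∑' a : A (n + N),
      Metric.ediam (Icc a.1 (a.1 + β ^ (-(u * (n + N : ℕ))))) ^ s ≤ f (n + N) := by
    intro n
    have := (hA (n + N)).fintype
    simp only [hdiam]
    rw [tsum_fintype, Finset.sum_const, Finset.card_univ, ← Nat.card_eq_fintype_card,
      Nat.card_coe_set_eq, nsmul_eq_mul, ENNReal.ofReal_rpow_of_pos (by positivity),
      ← ENNReal.ofReal_natCast, ← ENNReal.ofReal_mul (by positivity), ← Real.rpow_mul hβ0.le]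
    refine ENNReal.ofReal_le_ofReal ((mul_le_mul_of_nonneg_right (hcard _)
      (by positivity)).trans_eq ?_)
    rw [mul_assoc, ← Real.rpow_add hβ0]
    congr 2
    ring
  calc _ ≤ ∑' n, f (n + N) := ENNReal.tsum_le_tsum hterm
    _ ≤ ∑' n, f n := ENNReal.tsum_comp_le_tsum_of_injective (add_left_injective N) f

theorem mem_Icc_leftEndpoint {β x u : ℝ} (hβ : 1 < β) (hx : 0 ≤ x) {n : ℕ}
    (h : (betaMap β)^[n] x ≤ β ^ (-(u * n))) :
    x ∈ Icc (x - (β ^ n)⁻¹ * (betaMap β)^[n] x)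
      (x - (β ^ n)⁻¹ * (betaMap β)^[n] x + β ^ (-((1 + u) * n))) := by
  have hβ0 : 0 < β := by linarith
  have hp : (0 : ℝ) < (β ^ n)⁻¹ := by positivity
  have h1 : β ^ (-((1 + u) * n)) = (β ^ n)⁻¹ * β ^ (-(u * n)) := by
    rw [← Real.rpow_natCast, ← Real.rpow_neg hβ0.le, ← Real.rpow_add hβ0]
    congr 1
    ring
  have h2 := betaMap_iterate_nonneg β hx n
  rw [h1]
  constructor
  · nlinarith
  · have := mul_le_mul_of_nonneg_left h hp.le
    linarith

theorem dimH_betaExp_eq_top {β : ℝ} (hβ : 1 < β) :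
    dimH {x : ℝ | x ∈ Icc (0 : ℝ) 1 ∧ betaExp β x = ⊤} = 0 := by
  have hsub : {x : ℝ | x ∈ Icc (0 : ℝ) 1 ∧ betaExp β x = ⊤} ⊆
      {x : ℝ | x ∈ Ico (0 : ℝ) 1 ∧ betaExp β x = ⊤} ∪ {1} := by
    rintro x ⟨hx, h⟩
    rcases hx.2.lt_or_eq with h1 | h1
    · exact Or.inl ⟨⟨hx.1, h1⟩, h⟩
    · exact Or.inr h1
  refine le_antisymm ((dimH_mono hsub).trans ?_) bot_le
  rw [dimH_union, dimH_singleton, max_eq_left zero_le]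
  refine ENNReal.le_of_forall_pos_le_add fun s hs _ => ?_
  rw [zero_add, ← ENNReal.ofReal_coe_nnreal]
  have hs' : (0 : ℝ) < s := hs
  -- With `u = 1 + 1/s` the condition `τ < s * u` reads `1 < s + 1`.
  refine dimH_le_of_frequently_mem_Icc (A := leftEndpoints β) (K := β / (β - 1)) (τ := 1)
    (u := 1 + 1 / s) hβ (leftEndpoints_finite hβ) (fun n => ?_) hs'.le (by positivity) ?_ ?_
  · rw [one_mul, Real.rpow_natCast]
    exact ncard_leftEndpoints_le hβ n
  · rw [mul_add, mul_one_div_cancel hs'.ne']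
    linarith
  · rintro x ⟨hx, h⟩
    have hlt : ((1 / s : ℝ) : EReal) < betaExp β x := by rw [h]; exact EReal.coe_lt_top _
    refine (frequently_of_lt_betaExp hβ hlt).mono fun n hn => ?_
    exact ⟨_, ⟨x, hx, rfl⟩, mem_Icc_leftEndpoint hβ hx.1 hn.2.le⟩

/-! ### Counting the cylinders met at record times -/

/-- Points whose orbit stays away from `0` at rate `u` and comes close to `0` uniformly at
rate `w`, with constants controlled by `c`. -/
def uniformApproxSet (β u w : ℝ) (c : ℕ) : Set ℝ :=
  {x | x ∈ Ico (0 : ℝ) 1 ∧ (∀ n : ℕ, β ^ (-(u * n + c)) ≤ (betaMap β)^[n] x) ∧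
    ∀ N : ℕ, c ≤ N → ∃ n, 1 ≤ n ∧ n ≤ N ∧ (betaMap β)^[n] x < β ^ (-(w * N))}

/-- The left end points of the cylinders of order `n` containing a point of `uniformApproxSet`
for which `n` is a record time. -/
def recordEndpoints (β u w : ℝ) (c n : ℕ) : Set ℝ :=
  (fun x => x - (β ^ n)⁻¹ * (betaMap β)^[n] x) ''
    {x | x ∈ uniformApproxSet β u w c ∧ IsRecordTime β x n}

theorem recordEndpoints_subset_leftEndpoints (β u w : ℝ) (c n : ℕ) :
    recordEndpoints β u w c n ⊆ leftEndpoints β n :=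
  image_mono fun _ hx => hx.1.1

theorem recordEndpoints_finite {β : ℝ} (hβ : 1 < β) (u w : ℝ) (c n : ℕ) :
    (recordEndpoints β u w c n).Finite :=
  (leftEndpoints_finite hβ n).subset (recordEndpoints_subset_leftEndpoints β u w c n)

open Classical in
-- The recursion behind the count: previous record cylinder, forced zeros, free remainder. The last
-- filter condition holds because `T^r x ≥ β^(-(ur+c))` limits the run of zeros starting at `r`, so
-- `r` cannot be small.
theorem recordEndpoints_subset_biUnion {β u w : ℝ} (hβ : 1 < β) (hw : 0 ≤ w) {c n : ℕ}
    (h2 : 2 ≤ n) (hc : c < n) :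
    recordEndpoints β u w c n ⊆ ⋃ r ∈ (Finset.range n).filter fun r =>
        r + ⌊w * (n - 1 : ℕ)⌋₊ ≤ n ∧ w * (n - 1 : ℕ) ≤ u * r + c,
      (fun p : ℝ × ℝ => p.1 + (β ^ (r + ⌊w * (n - 1 : ℕ)⌋₊))⁻¹ * p.2) ''
        recordEndpoints β u w c r ×ˢ leftEndpoints β (n - (r + ⌊w * (n - 1 : ℕ)⌋₊)) := by
  rintro _ ⟨x, ⟨hx, hrec⟩, rfl⟩
  have hβ0 : 0 < β := by linarith
  obtain ⟨r, hr, hrn, hlt, hadd⟩ := hrec.exists_previous (w := w) hβ hx.1.1 h2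
    (hx.2.2 (n - 1) (by omega))
  set z := ⌊w * (n - 1 : ℕ)⌋₊ with hz
  have hzle : (z : ℝ) ≤ w * (n - 1 : ℕ) := Nat.floor_le (by positivity)
  have hrz : r + z ≤ n := by
    have : ((r + z : ℕ) : ℝ) < n := by push_cast; linarith
    exact_mod_cast this.le
  have hur : w * (n - 1 : ℕ) ≤ u * r + c := by
    have := (Real.rpow_lt_rpow_left_iff hβ).1 ((hx.2.1 r).trans_lt hlt)
    linarith
  simp only [mem_iUnion, Finset.mem_filter, Finset.mem_range]
  have hTz : (betaMap β)^[z + r] x = β ^ z * (betaMap β)^[r] x := by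
    rw [Function.iterate_add_apply]
    refine betaMap_iterate_eq_pow_mul hβ (betaMap_iterate_nonneg β hx.1.1 r) ?_
    have hle : (β : ℝ) ^ z ≤ β ^ (w * (n - 1 : ℕ)) := by
      rw [← Real.rpow_natCast]
      exact Real.rpow_le_rpow_of_exponent_le hβ.le hzle
    calc β ^ z * (betaMap β)^[r] x < β ^ z * β ^ (-(w * (n - 1 : ℕ))) := by gcongr
      _ ≤ β ^ (w * (n - 1 : ℕ)) * β ^ (-(w * (n - 1 : ℕ))) := by gcongr
      _ = 1 := by rw [← Real.rpow_add hβ0, add_neg_cancel, Real.rpow_zero]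
  have hmem : (betaMap β)^[z + r] x ∈ Ico (0 : ℝ) 1 := betaMap_iterate_mem_Ico β hx.1 _
  refine ⟨r, ⟨hrn, hrz, hur⟩, ⟨_, _⟩, ⟨⟨x, ⟨hx, hr⟩, rfl⟩, ⟨_, hmem, rfl⟩⟩, ?_⟩
  dsimp only
  rw [← Function.iterate_add_apply, show n - (r + z) + (z + r) = n by omega, hTz]
  obtain ⟨k, hk⟩ := Nat.exists_eq_add_of_le hrz
  rw [show n - (r + z) = k by omega, show (β : ℝ) ^ n = β ^ r * β ^ z * β ^ k by
    rw [hk, pow_add, pow_add], pow_add]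
  field_simp
  ring

open Classical in
-- Inserting the bound for `r` into the recursion gives the exponent `(1-w)n - (1-τ)r` up to
-- constants, with `r ≥ wn/u` roughly. By `hδ` this is below `τn` by a margin `δn`, which absorbs
-- the at most `n` choices of `r`.
theorem exists_ncard_recordEndpoints_le {β u w τ : ℝ} (hβ : 1 < β) (hw : 0 < w) (hu : 0 < u)
    (hτ0 : 0 ≤ τ) (hτ1 : τ < 1) (hδ : 1 - w < τ + (1 - τ) * (w / u)) (c : ℕ) :
    ∃ K : ℝ, ∀ n : ℕ, ((recordEndpoints β u w c n).ncard : ℝ) ≤ K * β ^ (τ * n) := by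
  have hβ0 : 0 < β := by linarith
  set C := β / (β - 1) with hC
  have hC0 : 0 < C := div_pos hβ0 (by linarith)
  set δ := τ + (1 - τ) * (w / u) - (1 - w) with hδ'
  have hδ0 : 0 < δ := by linarith
  -- `D` collects the bounded losses: the floor in the zero run, `n - 1` in place of `n`, and the
  -- constant `c`.
  set D := w + 1 + (1 - τ) * ((w + c) / u) with hD
  have hlim : Tendsto (fun n : ℕ => C * β ^ D * (n * (β ^ (-δ)) ^ n)) atTop (nhds 0) := by
    simpa using (tendsto_self_mul_const_pow_of_lt_one (by positivity)
      (Real.rpow_lt_one_of_one_lt_of_neg hβ (by linarith : -δ < 0))).const_mul (C * β ^ D)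
  obtain ⟨n₁, hn₁⟩ := eventually_atTop.1 (hlim.eventually (gt_mem_nhds one_pos))
  set n₂ := n₁ + c + 2 with hn₂
  refine ⟨C * β ^ n₂, fun n => ?_⟩
  have hK0 : 0 ≤ C * β ^ n₂ := by positivity
  induction n using Nat.strong_induction_on with
  | _ n ih =>
    by_cases hn : n < n₂
    · have h1 : ((recordEndpoints β u w c n).ncard : ℝ) ≤ C * β ^ n := by
        refine le_trans (Nat.cast_le.2 ?_) (ncard_leftEndpoints_le hβ n)
        exact ncard_le_ncard (recordEndpoints_subset_leftEndpoints β u w c n)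
          (leftEndpoints_finite hβ n)
      have h2 : C * β ^ n ≤ C * β ^ n₂ := by gcongr; exact hβ.le
      have h3 : 1 ≤ β ^ (τ * n) := Real.one_le_rpow hβ.le (by positivity)
      nlinarith
    · push Not at hn
      have hn1 : ((n - 1 : ℕ) : ℝ) = n - 1 := by rw [Nat.cast_sub (by omega)]; simp
      set z := ⌊w * (n - 1 : ℕ)⌋₊ with hz
      have hz1 : w * (n - 1) < z + 1 := by
        rw [← hn1]
        exact Nat.lt_floor_add_one _
      have hfin : ∀ r, (recordEndpoints β u w c r ×ˢ leftEndpoints β (n - (r + z))).Finite :=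
        fun r => (recordEndpoints_finite hβ u w c r).prod (leftEndpoints_finite hβ _)
      have hsub := recordEndpoints_subset_biUnion (u := u) hβ hw.le (c := c) (n := n)
        (by omega) (by omega)
      set R := (Finset.range n).filter fun r => r + z ≤ n ∧ w * (n - 1 : ℕ) ≤ u * r + c with hR
      have hU := ncard_biUnion_image_le R
        (fun r => recordEndpoints β u w c r ×ˢ leftEndpoints β (n - (r + z)))
        (fun r (p : ℝ × ℝ) => p.1 + (β ^ (r + z))⁻¹ * p.2) fun r _ => hfin r
      have hcard := (ncard_le_ncard hsub hU.1).trans hU.2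
      have hterm : ∀ r ∈ R, ((recordEndpoints β u w c r ×ˢ
          leftEndpoints β (n - (r + z))).ncard : ℝ) ≤
          C * β ^ n₂ * (C * β ^ D * β ^ (-(δ * n))) * β ^ (τ * n) := by
        intro r hr
        simp only [hR, Finset.mem_filter, Finset.mem_range] at hr
        obtain ⟨hrn, hrz, hur⟩ := hr
        rw [hn1] at hur
        rw [ncard_prod, Nat.cast_mul]
        have h1 : ((n - (r + z) : ℕ) : ℝ) = n - (r + z) := by
          rw [Nat.cast_sub hrz]; push_cast; ring
        have hr0 : w / u * (n - 1) - c / u ≤ r := by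
          have h : w * (n - 1) - c ≤ r * u := by linarith
          calc _ = (w * (n - 1) - c) / u := by ring
            _ ≤ r := (div_le_iff₀ hu).2 h
        have hexp : τ * r + (n - (r + z) : ℕ) ≤ D + -(δ * n) + τ * n := by
          have h2 := mul_le_mul_of_nonneg_left hr0 (by linarith : 0 ≤ 1 - τ)
          have h3 : D + -(δ * n) + τ * n = w + 1 + n * (1 - w) -
              (1 - τ) * (w / u * (n - 1) - c / u) := by
            rw [hD, hδ']
            ring
          rw [h1, h3]
          nlinarith
        calc _ ≤ (C * β ^ n₂ * β ^ (τ * r)) * (C * β ^ (n - (r + z))) :=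
              mul_le_mul (ih r hrn) (ncard_leftEndpoints_le hβ _) (by positivity) (by positivity)
          _ = C * β ^ n₂ * C * β ^ (τ * r + (n - (r + z) : ℕ)) := by
              rw [Real.rpow_add hβ0, Real.rpow_natCast]
              ring
          _ ≤ C * β ^ n₂ * C * β ^ (D + -(δ * n) + τ * n) := by
              gcongr
              exact hβ.le
          _ = _ := by
              rw [Real.rpow_add hβ0, Real.rpow_add hβ0]
              ring
      have hRn : (R.card : ℝ) ≤ n := by
        exact_mod_cast (Finset.card_filter_le _ _).trans_eq (Finset.card_range n)
      have hsmall := hn₁ n (by omega)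
      rw [← Real.rpow_mul_natCast hβ0.le, neg_mul] at hsmall
      calc ((recordEndpoints β u w c n).ncard : ℝ) ≤ ∑ r ∈ R, ((recordEndpoints β u w c r ×ˢ
            leftEndpoints β (n - (r + z))).ncard : ℝ) := by exact_mod_cast hcard
        _ ≤ R.card • (C * β ^ n₂ * (C * β ^ D * β ^ (-(δ * n))) * β ^ (τ * n)) :=
            Finset.sum_le_card_nsmul _ _ _ hterm
        _ ≤ n * (C * β ^ n₂ * (C * β ^ D * β ^ (-(δ * n))) * β ^ (τ * n)) := by
            rw [nsmul_eq_mul]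
            gcongr
        _ = C * β ^ n₂ * (C * β ^ D * (n * β ^ (-(δ * n)))) * β ^ (τ * n) := by ring
        _ ≤ C * β ^ n₂ * 1 * β ^ (τ * n) := by gcongr
        _ = _ := by rw [mul_one]

/-- The upper bound for the dimension of the set of points with uniform exponent at least `v` and
exponent equal to `θ * v`. -/
theorem dimH_le_of_parameters {β v θ u w u' τ s : ℝ} (hβ : 1 < β) (hw : 0 < w) (hwv : w < v)
    (hu' : 0 < u') (hu'v : u' < θ * v) (huv : θ * v < u) (hτ0 : 0 ≤ τ) (hτ1 : τ < 1)
    (hδ : 1 - w < τ + (1 - τ) * (w / u)) (hs : 0 ≤ s) (hτs : τ < s * (1 + u')) :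
    dimH {x : ℝ | x ∈ Ico (0 : ℝ) 1 ∧ (v : EReal) ≤ betaUniformExp β x ∧
      betaExp β x = ((θ * v : ℝ) : EReal)} ≤ ENNReal.ofReal s := by
  have hsub : {x : ℝ | x ∈ Ico (0 : ℝ) 1 ∧ (v : EReal) ≤ betaUniformExp β x ∧
      betaExp β x = ((θ * v : ℝ) : EReal)} ⊆ ⋃ c : ℕ, {x | x ∈ uniformApproxSet β u w c ∧
        ∃ᶠ n : ℕ in atTop, 1 ≤ n ∧ (betaMap β)^[n] x < β ^ (-(u' * n))} := by
    rintro x ⟨hx, hxv, hxe⟩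
    obtain ⟨c₁, hc₁⟩ := exists_forall_rpow_le_iterate (v := u) hβ hx.1
      (by rw [hxe]; exact EReal.coe_lt_coe_iff.2 huv)
    obtain ⟨c₂, hc₂⟩ := eventually_atTop.1 (eventually_of_lt_betaUniformExp hβ
      ((EReal.coe_lt_coe_iff.2 hwv).trans_le hxv))
    refine mem_iUnion.2 ⟨c₁ + c₂, ⟨hx, fun n => ?_, fun N hN => hc₂ N (by omega)⟩, ?_⟩
    · refine le_trans (Real.rpow_le_rpow_of_exponent_le hβ.le ?_) (hc₁ n)
      push_cast
      linarith [(Nat.cast_nonneg c₂ : (0 : ℝ) ≤ c₂)]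
    · exact frequently_of_lt_betaExp hβ (by rw [hxe]; exact EReal.coe_lt_coe_iff.2 hu'v)
  refine (dimH_mono hsub).trans ?_
  rw [dimH_iUnion]
  refine iSup_le fun c => ?_
  have hu0 : 0 < u := by linarith
  obtain ⟨K, hK⟩ := exists_ncard_recordEndpoints_le hβ hw hu0 hτ0 hτ1 hδ c
  refine dimH_le_of_frequently_mem_Icc (A := recordEndpoints β u w c) (u := 1 + u') hβ
    (recordEndpoints_finite hβ u w c) hK hs (by linarith) hτs ?_
  rintro x ⟨hx, hfreq⟩
  have hpos : ∀ n, 0 < (betaMap β)^[n] x := fun n =>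
    (Real.rpow_pos_of_pos (by linarith) _).trans_le (hx.2.1 n)
  refine frequently_atTop.2 fun m => ?_
  -- A time `n` of good approximation need not be a record, but the record `r ≤ n` inherits `T^r x <
  -- β^(-u'n) ≤ β^(-u'r)`.
  obtain ⟨r, n, hmr, hrn, hn, hrec, hle⟩ := exists_isRecordTime_ge hpos
    (p := fun n => (betaMap β)^[n] x < β ^ (-(u' * n))) (fun δ hδ => by
      obtain ⟨n, ⟨h1, h2⟩, h3⟩ := (hfreq.and_eventually
        ((tendsto_rpow_neg_mul_atTop hβ hu').eventually (gt_mem_nhds hδ))).exists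
      exact ⟨n, h1, h2, h2.trans h3⟩) m
  refine ⟨r, hmr, _, ⟨x, ⟨hx, hrec⟩, rfl⟩, mem_Icc_leftEndpoint hβ hx.1.1 ?_⟩
  refine (hle.trans hn.le).trans (Real.rpow_le_rpow_of_exponent_le hβ.le ?_)
  have : (r : ℝ) ≤ n := by exact_mod_cast hrn
  nlinarith

open Topology in
theorem dimH_level_set_le {β v θ : ℝ} (hβ : 1 < β) (hv : 0 < v) (hv1 : v < 1)
    (hθ : 1 / (1 - v) ≤ θ) :
    dimH {x : ℝ | x ∈ Icc (0 : ℝ) 1 ∧ (v : EReal) ≤ betaUniformExp β x ∧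
      betaExp β x = ((θ * v : ℝ) : EReal)} ≤
      ENNReal.ofReal ((θ - 1 - θ * v) / ((1 + θ * v) * (θ - 1))) := by
  have hθv : 1 ≤ θ * (1 - v) := (div_le_iff₀ (by linarith)).1 hθ
  have hθ0 : 0 < θ := by
    by_contra! h
    nlinarith
  have hθ1 : 1 < θ := by nlinarith
  have hsub : {x : ℝ | x ∈ Icc (0 : ℝ) 1 ∧ (v : EReal) ≤ betaUniformExp β x ∧
      betaExp β x = ((θ * v : ℝ) : EReal)} ⊆
      {x : ℝ | x ∈ Ico (0 : ℝ) 1 ∧ (v : EReal) ≤ betaUniformExp β x ∧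
      betaExp β x = ((θ * v : ℝ) : EReal)} ∪ {1} := by
    rintro x ⟨hx, h⟩
    rcases hx.2.lt_or_eq with h1 | h1
    · exact Or.inl ⟨⟨hx.1, h1⟩, h⟩
    · exact Or.inr h1
  refine (dimH_mono hsub).trans ?_
  rw [dimH_union, dimH_singleton, max_eq_left zero_le]
  -- `τ₀` solves `1 - v = τ + (1 - τ)/θ`, the limit case of the counting condition as `w → v` and `u
  -- → θv`. A slightly larger `τ` makes it strict, and a small `e` then separates `w`, `u` and `u'`
  -- from their limits.
  set τ₀ := 1 - θ * v / (θ - 1) with hτ₀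
  have hτ₀0 : 0 ≤ τ₀ := by
    rw [hτ₀, sub_nonneg, div_le_one (by linarith)]
    linarith
  have hτ₀1 : τ₀ < 1 := by
    have : 0 < θ * v / (θ - 1) := div_pos (by positivity) (by linarith)
    linarith
  have hσ : (θ - 1 - θ * v) / ((1 + θ * v) * (θ - 1)) = τ₀ / (1 + θ * v) := by
    have : θ - 1 ≠ 0 := by linarith
    rw [hτ₀]
    field_simp
  rw [hσ]
  have hσ0 : 0 ≤ τ₀ / (1 + θ * v) := by positivity
  refine ENNReal.le_of_forall_pos_le_add fun ε hε _ => ?_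
  have hε' : (0 : ℝ) < ε := hε
  rw [← ENNReal.ofReal_coe_nnreal, ← ENNReal.ofReal_add hσ0 hε'.le]
  set s := τ₀ / (1 + θ * v) + ε with hs
  have hτs : τ₀ < s * (1 + θ * v) := by
    rw [hs, add_mul, div_mul_cancel₀ _ (by positivity)]
    have : 0 < ε * (1 + θ * v) := by positivity
    linarith
  obtain ⟨τ, hττ₀, hτ1, hτs'⟩ : ∃ τ, τ₀ < τ ∧ τ < 1 ∧ τ < s * (1 + θ * v) := by
    obtain ⟨τ, h1, h2⟩ := exists_between (lt_min hτ₀1 hτs)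
    exact ⟨τ, h1, h2.trans_le (min_le_left _ _), h2.trans_le (min_le_right _ _)⟩
  have hlim : 1 - v < τ + (1 - τ) * (v / (θ * v)) := by
    have h1 : v / (θ * v) = 1 / θ := by field_simp
    have h2 : θ * v / (θ - 1) = 1 - τ₀ := by rw [hτ₀]; ring
    rw [div_eq_iff (by linarith)] at h2
    rw [h1]
    have h3 : (1 - τ) * (1 - 1 / θ) < v := by
      have h4 : v = (1 - τ₀) * (1 - 1 / θ) := by
        field_simp
        linarith
      rw [h4]
      have : 0 < 1 - 1 / θ := by
        rw [sub_pos, div_lt_one hθ0]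
        exact hθ1
      gcongr
    linarith
  have hθv0 : 0 < θ * v := by positivity
  obtain ⟨e, he0, hwpos, hupos, hδ, hs'⟩ : ∃ e > 0, 0 < v - e ∧ 0 < θ * v - e ∧
      1 - (v - e) < τ + (1 - τ) * ((v - e) / (θ * v + e)) ∧ τ < s * (1 + (θ * v - e)) := by
    have e1 : ∀ᶠ e in 𝓝 (0 : ℝ), 0 < v - e :=
      (show ContinuousAt (fun e : ℝ => v - e) 0 by fun_prop).eventually
        (lt_mem_nhds (by simpa using hv))
    have e2 : ∀ᶠ e in 𝓝 (0 : ℝ), 0 < θ * v - e :=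
      (show ContinuousAt (fun e : ℝ => θ * v - e) 0 by fun_prop).eventually
        (lt_mem_nhds (by simpa using hθv0))
    have e3 : ∀ᶠ e in 𝓝 (0 : ℝ), 0 <
        τ + (1 - τ) * ((v - e) / (θ * v + e)) - (1 - (v - e)) := by
      have hne : θ * v + 0 ≠ 0 := by simpa using hθv0.ne'
      have hc : ContinuousAt (fun e : ℝ =>
          τ + (1 - τ) * ((v - e) / (θ * v + e)) - (1 - (v - e))) 0 := by
        fun_prop (disch := assumption)
      exact hc.eventually (lt_mem_nhds (by simpa using hlim))
    have e4 : ∀ᶠ e in 𝓝 (0 : ℝ), τ < s * (1 + (θ * v - e)) :=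
      (show ContinuousAt (fun e : ℝ => s * (1 + (θ * v - e))) 0 by fun_prop).eventually
        (lt_mem_nhds (by simpa using hτs'))
    obtain ⟨e, ⟨⟨⟨h1, h2⟩, h3⟩, h4⟩, h5⟩ := ((((e1.and e2).and e3).and e4).filter_mono
      (nhdsWithin_le_nhds (s := Ioi 0)) |>.and self_mem_nhdsWithin).exists
    exact ⟨e, h5, h1, h2, by linarith, h4⟩
  exact dimH_le_of_parameters hβ hwpos (by linarith) hupos (by linarith)
    (by linarith : θ * v < θ * v + e) (hτ₀0.trans hττ₀.le) hτ1 hδ (by positivity) hs'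

/-! ### Points prescribed by blocks of digits -/

/-- The point whose expansion consists of the blocks `a j`, `a (j + 1)`, … of length `ℓ + 1`. -/
noncomputable def blockSum (β : ℝ) (ℓ : ℕ) (a : ℕ → ℝ) (j : ℕ) : ℝ :=
  ∑' i, a (j + i) * ((β ^ (ℓ + 1))⁻¹) ^ i

section blockSum

variable {β : ℝ} {ℓ : ℕ} {a : ℕ → ℝ}

theorem inv_pow_succ_lt_inv_pow (hβ : 1 < β) (ℓ : ℕ) : (β ^ (ℓ + 1))⁻¹ < (β ^ ℓ)⁻¹ := by
  have hβ0 : 0 < β := by linarith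
  gcongr
  omega

theorem inv_pow_succ_lt_one (hβ : 1 < β) (ℓ : ℕ) : (β ^ (ℓ + 1))⁻¹ < 1 :=
  inv_lt_one_of_one_lt₀ (one_lt_pow₀ hβ (by omega))

theorem summable_blockSum (hβ : 1 < β) (ha : ∀ j, a j ∈ fullOffsets β ℓ) (j : ℕ) :
    Summable fun i => a (j + i) * ((β ^ (ℓ + 1))⁻¹) ^ i := by
  have hβ0 : 0 < β := by linarith
  have hp : (0 : ℝ) < (β ^ ℓ)⁻¹ := by positivity
  refine Summable.of_nonneg_of_le (fun i => mul_nonneg (ha _).1 (by positivity)) (fun i => ?_)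
    (summable_geometric_of_lt_one (r := (β ^ (ℓ + 1))⁻¹) (by positivity)
      (inv_pow_succ_lt_one hβ ℓ))
  exact mul_le_of_le_one_left (by positivity) (by linarith [(ha (j + i)).2.1])

theorem blockSum_eq_add (hβ : 1 < β) (ha : ∀ j, a j ∈ fullOffsets β ℓ) (j : ℕ) :
    blockSum β ℓ a j = a j + (β ^ (ℓ + 1))⁻¹ * blockSum β ℓ a (j + 1) := by
  rw [blockSum, (summable_blockSum hβ ha j).tsum_eq_zero_add, blockSum, ← tsum_mul_left]
  congr 1
  · simp
  · refine tsum_congr fun i => ?_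
    rw [pow_succ, show j + (i + 1) = j + 1 + i by ring]
    ring

theorem blockSum_mem_Ico (hβ : 1 < β) (ha : ∀ j, a j ∈ fullOffsets β ℓ) (j : ℕ) :
    blockSum β ℓ a j ∈ Ico (0 : ℝ) 1 := by
  have hβ0 : 0 < β := by linarith
  have hb1 := inv_pow_succ_lt_one hβ ℓ
  have hbl := inv_pow_succ_lt_inv_pow hβ ℓ
  have hb0 : (0 : ℝ) < (β ^ (ℓ + 1))⁻¹ := by positivity
  have hle : ∀ j, blockSum β ℓ a j ≤ 1 := fun j => by
    have hs := summable_geometric_of_lt_one hb0.le hb1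
    calc blockSum β ℓ a j ≤ ∑' i : ℕ, (1 - (β ^ (ℓ + 1))⁻¹) * ((β ^ (ℓ + 1))⁻¹) ^ i := by
          refine (summable_blockSum hβ ha j).tsum_le_tsum (fun i => ?_) (hs.mul_left _)
          gcongr
          linarith [(ha (j + i)).2.1]
      _ = 1 := by
          rw [tsum_mul_left, tsum_geometric_of_lt_one hb0.le hb1]
          exact mul_inv_cancel₀ (by linarith)
  refine ⟨tsum_nonneg fun i => mul_nonneg (ha _).1 (by positivity), ?_⟩
  rw [blockSum_eq_add hβ ha]
  nlinarith [hle (j + 1), (ha j).2.1]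

/-- Each offset is also full of order `ℓ + 1`, so `T^(ℓ+1)` removes exactly one block. -/
theorem iterate_blockSum (hβ : 1 < β) (ha : ∀ j, a j ∈ fullOffsets β ℓ) (j : ℕ) :
    (betaMap β)^[(ℓ + 1) * j] (blockSum β ℓ a 0) = blockSum β ℓ a j := by
  induction j with
  | zero => simp
  | succ j ih =>
    rw [mul_add, mul_one, add_comm, Function.iterate_add_apply, ih, blockSum_eq_add hβ ha j]
    exact (fullOffsets_subset_succ hβ ℓ (ha j)).2.2 _ (blockSum_mem_Ico hβ ha (j + 1))

theorem blockSum_eq_pow_mul (hβ : 1 < β) (ha : ∀ j, a j ∈ fullOffsets β ℓ) {j k : ℕ}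
    (hjk : j ≤ k) (h0 : ∀ i, j ≤ i → i < k → a i = 0) :
    blockSum β ℓ a j = ((β ^ (ℓ + 1))⁻¹) ^ (k - j) * blockSum β ℓ a k := by
  induction k, hjk using Nat.le_induction with
  | base => simp
  | succ k hk ih =>
    rw [ih fun i h1 h2 => h0 i h1 (by omega), blockSum_eq_add hβ ha k, h0 k hk (by omega),
      Nat.sub_add_comm hk, pow_succ]
    ring

theorem blockSum_sub_blockSum (hβ : 1 < β) {a' : ℕ → ℝ} (ha : ∀ j, a j ∈ fullOffsets β ℓ)
    (ha' : ∀ j, a' j ∈ fullOffsets β ℓ) {j : ℕ} (h : ∀ i < j, a i = a' i) :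
    blockSum β ℓ a 0 - blockSum β ℓ a' 0 =
      ((β ^ (ℓ + 1))⁻¹) ^ j * (blockSum β ℓ a j - blockSum β ℓ a' j) := by
  induction j with
  | zero => simp
  | succ j ih =>
    rw [ih fun i hi => h i (by omega), blockSum_eq_add hβ ha j, blockSum_eq_add hβ ha' j,
      h j (by omega), pow_succ]
    ring

/-- The extra zero digit ending each block creates the gap: distinct offsets differ by at least
`β^(-ℓ)`, while the tails contribute at most `β^(-(ℓ+1))`. -/
theorem le_abs_blockSum_sub (hβ : 1 < β) {a' : ℕ → ℝ} (ha : ∀ j, a j ∈ fullOffsets β ℓ)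
    (ha' : ∀ j, a' j ∈ fullOffsets β ℓ) {j : ℕ} (h : ∀ i < j, a i = a' i) (hne : a j ≠ a' j) :
    ((β ^ (ℓ + 1))⁻¹) ^ j * ((β ^ ℓ)⁻¹ - (β ^ (ℓ + 1))⁻¹) ≤
      |blockSum β ℓ a 0 - blockSum β ℓ a' 0| := by
  have hβ0 : 0 < β := by linarith
  have hb0 : (0 : ℝ) < (β ^ (ℓ + 1))⁻¹ := by positivity
  rw [blockSum_sub_blockSum hβ ha ha' h, abs_mul, abs_of_pos (pow_pos hb0 j)]
  gcongr
  have hsep : (β ^ ℓ)⁻¹ ≤ |a j - a' j| := by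
    rcases hne.lt_or_gt with h | h
    · rw [abs_sub_comm]
      exact (fullOffsets_separated hβ (ha j) (ha' j) h).trans (le_abs_self _)
    · exact (fullOffsets_separated hβ (ha' j) (ha j) h).trans (le_abs_self _)
  have h1 := blockSum_mem_Ico hβ ha (j + 1)
  have h2 := blockSum_mem_Ico hβ ha' (j + 1)
  have h3 : |blockSum β ℓ a (j + 1) - blockSum β ℓ a' (j + 1)| ≤ 1 := by
    rw [abs_le]
    constructor <;> linarith [h1.1, h1.2, h2.1, h2.2]
  have h4 : a j - a' j = (blockSum β ℓ a j - blockSum β ℓ a' j) -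
      (β ^ (ℓ + 1))⁻¹ * (blockSum β ℓ a (j + 1) - blockSum β ℓ a' (j + 1)) := by
    rw [blockSum_eq_add hβ ha j, blockSum_eq_add hβ ha' j]
    ring
  rw [h4] at hsep
  have h5 := abs_sub (blockSum β ℓ a j - blockSum β ℓ a' j)
    ((β ^ (ℓ + 1))⁻¹ * (blockSum β ℓ a (j + 1) - blockSum β ℓ a' (j + 1)))
  rw [abs_mul, abs_of_pos hb0] at h5
  nlinarith

end blockSum

/-! ### Positions of the blocks of zeros -/

/-- The beginning of the `i`-th long block of zeros. -/
noncomputable def zeroStart (A θ : ℝ) (i : ℕ) : ℕ := ⌊A * θ ^ i⌋₊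

/-- The end of the `i`-th long block of zeros. -/
noncomputable def zeroEnd (A θ v : ℝ) (i : ℕ) : ℕ :=
  zeroStart A θ i + ⌊θ * v * zeroStart A θ i⌋₊

/-- The positions covered by the long blocks of zeros. -/
def zeroPositions (A θ v : ℝ) : Set ℕ := {j | ∃ i, zeroStart A θ i ≤ j ∧ j < zeroEnd A θ v i}

theorem lt_zeroStart (A θ : ℝ) (i : ℕ) : A * θ ^ i - 1 < zeroStart A θ i := by
  have := Nat.lt_floor_add_one (A * θ ^ i)
  rw [zeroStart]
  linarith

theorem lt_zeroEnd (A θ v : ℝ) (i : ℕ) :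
    zeroStart A θ i + θ * v * zeroStart A θ i - 1 < (zeroEnd A θ v i : ℝ) := by
  rw [zeroEnd]
  push_cast
  linarith [Nat.lt_floor_add_one (θ * v * zeroStart A θ i)]

theorem zeroStart_le_zeroEnd (A θ v : ℝ) (i : ℕ) : zeroStart A θ i ≤ zeroEnd A θ v i :=
  Nat.le_add_right _ _

/-- The conditions on the parameters ensuring that the blocks of zeros are disjoint. -/
structure ZeroParameters (A θ v : ℝ) : Prop where
  one_lt : 1 < θ
  v_pos : 0 < v
  A_pos : 0 < A
  large : 1 < A * (θ - 1 - θ * v)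

namespace ZeroParameters

variable {A θ v : ℝ}

theorem theta_pos (h : ZeroParameters A θ v) : 0 < θ := by linarith [h.one_lt]

theorem scale_pos (h : ZeroParameters A θ v) (i : ℕ) : 0 < A * θ ^ i :=
  mul_pos h.A_pos (pow_pos h.theta_pos i)

theorem zeroStart_le (h : ZeroParameters A θ v) (i : ℕ) : (zeroStart A θ i : ℝ) ≤ A * θ ^ i :=
  Nat.floor_le (h.scale_pos i).le

theorem length_nonneg (h : ZeroParameters A θ v) (i : ℕ) : 0 ≤ θ * v * zeroStart A θ i := by
  have := h.theta_pos
  have := h.v_pos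
  positivity

theorem zeroEnd_le (h : ZeroParameters A θ v) (i : ℕ) :
    (zeroEnd A θ v i : ℝ) ≤ zeroStart A θ i + θ * v * zeroStart A θ i := by
  rw [zeroEnd]
  push_cast
  gcongr
  exact Nat.floor_le (h.length_nonneg i)

/-- Without roundings the gap is `θ^i A(θ - 1 - θv)`, which exceeds `1` and so absorbs the floor. -/
theorem zeroEnd_lt_zeroStart (h : ZeroParameters A θ v) (i : ℕ) :
    zeroEnd A θ v i < zeroStart A θ (i + 1) := by
  have h1 := h.zeroEnd_le i
  have h2 := h.zeroStart_le i
  have h3 := lt_zeroStart A θ (i + 1)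
  have hθ := h.theta_pos
  have hv := h.v_pos
  have h4 : (zeroStart A θ i : ℝ) * (1 + θ * v) ≤ A * θ ^ i * (1 + θ * v) := by gcongr
  have h5 : A * (θ - 1 - θ * v) ≤ θ ^ i * (A * (θ - 1 - θ * v)) := by
    have := one_le_pow₀ h.one_lt.le (n := i)
    nlinarith [h.large]
  rw [pow_succ] at h3
  have : (zeroEnd A θ v i : ℝ) < zeroStart A θ (i + 1) := by nlinarith [h.large]
  exact_mod_cast this

theorem strictMono_zeroStart (h : ZeroParameters A θ v) : StrictMono (zeroStart A θ) :=
  strictMono_nat_of_lt_succ fun i =>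
    (zeroStart_le_zeroEnd A θ v i).trans_lt (h.zeroEnd_lt_zeroStart i)

theorem tendsto_zeroStart (h : ZeroParameters A θ v) : Tendsto (zeroStart A θ) atTop atTop :=
  h.strictMono_zeroStart.tendsto_atTop

theorem strictMono_zeroEnd (h : ZeroParameters A θ v) : StrictMono (zeroEnd A θ v) :=
  strictMono_nat_of_lt_succ fun i =>
    (h.zeroEnd_lt_zeroStart i).trans_le (zeroStart_le_zeroEnd A θ v _)

theorem notMem_of_between (h : ZeroParameters A θ v) {i j : ℕ} (h1 : zeroEnd A θ v i ≤ j)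
    (h2 : j < zeroStart A θ (i + 1)) :
    j ∉ zeroPositions A θ v := by
  rintro ⟨k, hk1, hk2⟩
  rcases Nat.lt_or_ge i k with hik | hik
  · have := h.strictMono_zeroStart.monotone (show i + 1 ≤ k from hik)
    omega
  · have := h.strictMono_zeroEnd.monotone hik
    omega

theorem notMem_of_lt (h : ZeroParameters A θ v) {j : ℕ} (hj : j < zeroStart A θ 0) :
    j ∉ zeroPositions A θ v := by
  rintro ⟨k, hk1, -⟩
  have := h.strictMono_zeroStart.monotone (Nat.zero_le k)
  omega

theorem zeroEnd_notMem (h : ZeroParameters A θ v) (i : ℕ) : zeroEnd A θ v i ∉ zeroPositions A θ v :=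
  h.notMem_of_between le_rfl (h.zeroEnd_lt_zeroStart i)

theorem infinite_setOf_notMem (h : ZeroParameters A θ v) : {j | j ∉ zeroPositions A θ v}.Infinite :=
  infinite_of_injective_forall_mem h.strictMono_zeroEnd.injective h.zeroEnd_notMem

theorem exists_between (h : ZeroParameters A θ v) {j : ℕ} (hj : zeroStart A θ 0 ≤ j) :
    ∃ i, zeroStart A θ i ≤ j ∧ j < zeroStart A θ (i + 1) := by
  have hex : ∃ k, j < zeroStart A θ k := (h.tendsto_zeroStart.eventually_gt_atTop j).exists
  classical
  have hk := Nat.find_spec hex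
  have h0 : Nat.find hex ≠ 0 := fun h0 => by rw [h0] at hk; omega
  refine ⟨Nat.find hex - 1, not_lt.1 (Nat.find_min hex (by omega)), ?_⟩
  rwa [Nat.sub_add_cancel (by omega)]

end ZeroParameters

open Classical in
/-- The number of free positions before `j`. -/
noncomputable def freeCount (A θ v : ℝ) (j : ℕ) : ℕ := Nat.count (· ∉ zeroPositions A θ v) j

theorem freeCount_mono (A θ v : ℝ) : Monotone (freeCount A θ v) := by
  classical
  exact Nat.count_monotone _

theorem freeCount_eq_add {A θ v : ℝ} {m n : ℕ} (hmn : m ≤ n)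
    (h : ∀ j, m ≤ j → j < n → j ∉ zeroPositions A θ v) :
    freeCount A θ v n = freeCount A θ v m + (n - m) := by
  classical
  induction n, hmn using Nat.le_induction with
  | base => simp
  | succ n hn ih =>
    have h1 := ih fun j h1 h2 => h j h1 (by omega)
    have h2 := h n hn (by omega)
    unfold freeCount at h1 ⊢
    rw [Nat.count_succ, h1, if_pos h2]
    omega

namespace ZeroParameters

variable {A θ v : ℝ}

/-- The subtracted term bounds the geometric sum of the lengths of all earlier zero blocks. -/
theorem freeCount_zeroStart (h : ZeroParameters A θ v) (i : ℕ) :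
    zeroStart A θ i - θ * v * (A * θ ^ i) / (θ - 1) ≤ (freeCount A θ v (zeroStart A θ i) : ℝ) := by
  have hθ := h.one_lt
  have hv := h.v_pos
  have hA := h.A_pos
  induction i with
  | zero =>
    have h1 := freeCount_eq_add (Nat.zero_le (zeroStart A θ 0)) fun j _ hj => h.notMem_of_lt hj
    rw [h1]
    push_cast
    have : 0 ≤ θ * v * (A * θ ^ 0) / (θ - 1) := div_nonneg (by positivity) (by linarith)
    have : (0 : ℝ) ≤ freeCount A θ v 0 := by positivity
    simp only [Nat.sub_zero]
    linarith
  | succ i ih =>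
    have h1 := freeCount_eq_add (h.zeroEnd_lt_zeroStart i).le
      fun j hj1 hj2 => h.notMem_of_between hj1 hj2
    have h2 := freeCount_mono A θ v (zeroStart_le_zeroEnd A θ v i)
    have h2' : (freeCount A θ v (zeroStart A θ i) : ℝ) ≤ freeCount A θ v (zeroEnd A θ v i) := by
      exact_mod_cast h2
    rw [h1, Nat.cast_add, Nat.cast_sub (h.zeroEnd_lt_zeroStart i).le]
    have h3 := h.zeroEnd_le i
    have h4 : θ * v * zeroStart A θ i ≤ θ * v * (A * θ ^ i) := by
      gcongr
      exact h.zeroStart_le i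
    have h5 : θ * v * (A * θ ^ (i + 1)) / (θ - 1) =
        θ * v * (A * θ ^ i) / (θ - 1) + θ * v * (A * θ ^ i) := by
      have : θ - 1 ≠ 0 := by linarith
      field_simp
      ring
    rw [h5]
    linarith

/-- The proportion of free positions. -/
theorem le_freeCount (h : ZeroParameters A θ v) {σ : ℝ}
    (hσ : σ = (θ - 1 - θ * v) / ((1 + θ * v) * (θ - 1))) (j : ℕ) :
    σ * j - 1 ≤ freeCount A θ v j := by
  have hθ := h.one_lt
  have hv := h.v_pos
  have hA := h.A_pos
  have hθv : 0 < θ * v := by positivity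
  have hθ1 : 0 < θ - 1 := by linarith
  have hnum : 0 < θ - 1 - θ * v := by
    have := h.large
    by_contra! hc
    nlinarith
  have hσ0 : 0 ≤ σ := by rw [hσ]; positivity
  have hσ1 : σ ≤ 1 := by
    rw [hσ, div_le_one (by positivity)]
    nlinarith
  have hσ2 : σ * (1 + θ * v) = 1 - θ * v / (θ - 1) := by
    rw [hσ]
    field_simp
  rcases Nat.lt_or_ge j (zeroStart A θ 0) with hj | hj
  · have h1 := freeCount_eq_add (Nat.zero_le j) fun k _ hk => h.notMem_of_lt (hk.trans hj)
    rw [h1]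
    push_cast
    have : (0 : ℝ) ≤ freeCount A θ v 0 := by positivity
    simp only [Nat.sub_zero]
    nlinarith [(Nat.cast_nonneg j : (0 : ℝ) ≤ j)]
  obtain ⟨i, hi1, hi2⟩ := h.exists_between hj
  -- Inside a zero block the count is constant, so its end is the worst case, and `hσ2` is the
  -- balance there. Afterwards the count grows by one per position, enough since `σ ≤ 1`.
  have key : ∀ k, zeroStart A θ i ≤ k → k ≤ zeroEnd A θ v i →
      σ * k - 1 ≤ freeCount A θ v k := fun k hk1 hk2 => by
    have h1 : (freeCount A θ v (zeroStart A θ i) : ℝ) ≤ freeCount A θ v k := by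
      exact_mod_cast freeCount_mono A θ v hk1
    have h2 : (k : ℝ) ≤ (1 + θ * v) * (A * θ ^ i) := by
      have h3 : (k : ℝ) ≤ zeroEnd A θ v i := by exact_mod_cast hk2
      have h4 := h.zeroEnd_le i
      have h5 := mul_le_mul_of_nonneg_left (h.zeroStart_le i) (by linarith : 0 ≤ 1 + θ * v)
      linarith
    have h3 := h.freeCount_zeroStart i
    have h4 := lt_zeroStart A θ i
    have h5 := mul_le_mul_of_nonneg_left h2 hσ0
    rw [← mul_assoc, hσ2] at h5
    have h6 : (1 - θ * v / (θ - 1)) * (A * θ ^ i) =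
        A * θ ^ i - θ * v * (A * θ ^ i) / (θ - 1) := by ring
    linarith
  rcases Nat.lt_or_ge j (zeroEnd A θ v i) with hj' | hj'
  · exact key j hi1 hj'.le
  · have h1 := freeCount_eq_add hj' fun k hk1 hk2 => h.notMem_of_between hk1 (hk2.trans hi2)
    have h2 := key _ (zeroStart_le_zeroEnd A θ v i) le_rfl
    rw [h1, Nat.cast_add, Nat.cast_sub hj']
    have h3 : (zeroEnd A θ v i : ℝ) ≤ j := by exact_mod_cast hj'
    nlinarith

end ZeroParameters

/-! ### Exponents of points with prescribed blocks of zeros -/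

/-- `a` is a sequence of full offsets which vanishes exactly at the positions covered by the long
blocks of zeros. -/
structure IsBlockSequence (β A θ v : ℝ) (ℓ : ℕ) (a : ℕ → ℝ) : Prop where
  mem : ∀ j, a j ∈ fullOffsets β ℓ
  zero : ∀ j ∈ zeroPositions A θ v, a j = 0
  ne_zero : ∀ j ∉ zeroPositions A θ v, a j ≠ 0

theorem inv_pow_pow_eq_rpow {β : ℝ} (hβ : 1 < β) (m k : ℕ) :
    ((β ^ m)⁻¹) ^ k = β ^ (-((m : ℝ) * k)) := by
  rw [inv_pow, ← pow_mul, Real.rpow_neg (by linarith), ← Nat.cast_mul, Real.rpow_natCast]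

namespace IsBlockSequence

variable {β A θ v : ℝ} {ℓ : ℕ} {a : ℕ → ℝ}

theorem inv_pow_le (hβ : 1 < β) (ha : IsBlockSequence β A θ v ℓ a) {j : ℕ}
    (hj : j ∉ zeroPositions A θ v) : (β ^ (ℓ + 1))⁻¹ ≤ blockSum β ℓ a j := by
  have h0 : (0 : ℝ) ∈ fullOffsets β ℓ :=
    fullOffsets_mono hβ (Nat.zero_le ℓ) (zero_mem_fullOffsets_zero β)
  have h1 := fullOffsets_separated hβ h0 (ha.mem j) ((ha.mem j).1.lt_of_ne' (ha.ne_zero j hj))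
  have h2 := (blockSum_mem_Ico hβ ha.mem (j + 1)).1
  have hβ0 : 0 < β := by linarith
  have h3 : (0 : ℝ) ≤ (β ^ (ℓ + 1))⁻¹ := by positivity
  rw [blockSum_eq_add hβ ha.mem]
  nlinarith [inv_pow_succ_lt_inv_pow hβ ℓ]

/-- From `j` at most `B` zero blocks precede a nonzero one, which contributes one more factor. -/
theorem pow_le_blockSum (hβ : 1 < β) (h : ZeroParameters A θ v)
    (ha : IsBlockSequence β A θ v ℓ a) {j B : ℕ}
    (hB : ∀ i, zeroStart A θ i ≤ j → zeroEnd A θ v i - zeroStart A θ i ≤ B) :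
    ((β ^ (ℓ + 1))⁻¹) ^ (B + 1) ≤ blockSum β ℓ a j := by
  have hβ0 : 0 < β := by linarith
  have hb0 : (0 : ℝ) ≤ (β ^ (ℓ + 1))⁻¹ := by positivity
  have hb1 := (inv_pow_succ_lt_one hβ ℓ).le
  by_cases hj : j ∈ zeroPositions A θ v
  · obtain ⟨i, hi1, hi2⟩ := id hj
    rw [blockSum_eq_pow_mul hβ ha.mem hi2.le
      fun k hk1 hk2 => ha.zero k ⟨i, hi1.trans hk1, hk2⟩, pow_succ]
    have hle : zeroEnd A θ v i - j ≤ B := by have := hB i hi1; omega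
    exact mul_le_mul (pow_le_pow_of_le_one hb0 hb1 hle)
      (ha.inv_pow_le hβ (h.zeroEnd_notMem i)) hb0 (by positivity)
  · refine le_trans ?_ (ha.inv_pow_le hβ hj)
    exact pow_le_of_le_one hb0 hb1 (by omega)

theorem rpow_le_iterate (hβ : 1 < β) (h : ZeroParameters A θ v)
    (ha : IsBlockSequence β A θ v ℓ a) {n B : ℕ}
    (hB : ∀ i, zeroStart A θ i ≤ (n + ℓ) / (ℓ + 1) → zeroEnd A θ v i - zeroStart A θ i ≤ B) :
    β ^ (-(((ℓ + 1 : ℕ) : ℝ) * (B + 2))) ≤ (betaMap β)^[n] (blockSum β ℓ a 0) := by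
  have hβ0 : 0 < β := by linarith
  -- This is the ceiling of `n / (ℓ + 1)`. Reaching that block boundary costs at most `ℓ + 1`
  -- factors `β`, hence `B + 2` where the block estimate has `B + 1`.
  set j := (n + ℓ) / (ℓ + 1) with hj
  have h1 := ha.pow_le_blockSum hβ h hB
  have hn1 : n ≤ (ℓ + 1) * j := by
    have h2 : (ℓ + 1) * j + (n + ℓ) % (ℓ + 1) = n + ℓ := Nat.div_add_mod (n + ℓ) (ℓ + 1)
    have h3 : (n + ℓ) % (ℓ + 1) < ℓ + 1 := Nat.mod_lt (n + ℓ) (Nat.succ_pos ℓ)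
    omega
  have hn2 : (ℓ + 1) * j - n ≤ ℓ + 1 := by
    have h2 : (ℓ + 1) * j ≤ n + ℓ := Nat.mul_div_le (n + ℓ) (ℓ + 1)
    omega
  have hT0 := betaMap_iterate_nonneg β (blockSum_mem_Ico hβ ha.mem 0).1 n
  have h2 := betaMap_iterate_le_pow_mul hβ hT0 ((ℓ + 1) * j - n)
  rw [← Function.iterate_add_apply, Nat.sub_add_cancel hn1, iterate_blockSum hβ ha.mem] at h2
  have h3 : β ^ ((ℓ + 1) * j - n) ≤ β ^ (ℓ + 1) := pow_le_pow_right₀ hβ.le hn2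
  have h4 : ((β ^ (ℓ + 1))⁻¹) ^ (B + 1) ≤
      β ^ (ℓ + 1) * (betaMap β)^[n] (blockSum β ℓ a 0) :=
    h1.trans (h2.trans (mul_le_mul_of_nonneg_right h3 hT0))
  have h5 := inv_pow_pow_eq_rpow hβ (ℓ + 1) (B + 2)
  push_cast at h5 ⊢
  rw [← h5, pow_succ _ (B + 1), mul_comm, inv_mul_le_iff₀ (by positivity)]
  exact h4

theorem iterate_zeroStart_lt (hβ : 1 < β) (ha : IsBlockSequence β A θ v ℓ a) (i : ℕ) :
    (betaMap β)^[(ℓ + 1) * zeroStart A θ i] (blockSum β ℓ a 0) <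
      β ^ (-(((ℓ + 1 : ℕ) : ℝ) * (θ * v * zeroStart A θ i - 1))) := by
  have hβ0 : 0 < β := by linarith
  rw [iterate_blockSum hβ ha.mem, blockSum_eq_pow_mul hβ ha.mem (zeroStart_le_zeroEnd A θ v i)
    fun k hk1 hk2 => ha.zero k ⟨i, hk1, hk2⟩, inv_pow_pow_eq_rpow hβ]
  have h1 := (blockSum_mem_Ico hβ ha.mem (zeroEnd A θ v i)).2
  refine (mul_lt_of_lt_one_right (by positivity) h1).trans_le ?_
  refine Real.rpow_le_rpow_of_exponent_le hβ.le (neg_le_neg ?_)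
  rw [Nat.cast_sub (zeroStart_le_zeroEnd A θ v i)]
  exact mul_le_mul_of_nonneg_left (by linarith [lt_zeroEnd A θ v i]) (by positivity)

theorem betaExp_le (hβ : 1 < β) (h : ZeroParameters A θ v)
    (ha : IsBlockSequence β A θ v ℓ a) :
    betaExp β (blockSum β ℓ a 0) ≤ ((θ * v : ℝ) : EReal) := by
  refine EReal.le_of_forall_lt_iff_le.1 fun u hu => ?_
  have hu' : θ * v < u := EReal.coe_lt_coe_iff.1 hu
  have hθv : 0 < θ * v := mul_pos h.theta_pos h.v_pos
  refine betaExp_le_of_eventually hβ ?_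
  have hlim : Tendsto (fun n : ℕ => (u - θ * v) * (n : ℝ)) atTop atTop :=
    tendsto_natCast_atTop_atTop.const_mul_atTop (by linarith)
  filter_upwards [hlim.eventually_ge_atTop ((θ * v + 2) * ((ℓ + 1 : ℕ) : ℝ))] with n hn
  set j := (n + ℓ) / (ℓ + 1) with hj
  refine le_trans (Real.rpow_le_rpow_of_exponent_le hβ.le ?_)
    (ha.rpow_le_iterate hβ h (n := n) (B := ⌊θ * v * j⌋₊) fun i hi => ?_)
  · have h1 : (⌊θ * v * j⌋₊ : ℝ) ≤ θ * v * j := Nat.floor_le (by positivity)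
    have h2 : ((ℓ + 1 : ℕ) : ℝ) * j ≤ n + (ℓ + 1 : ℕ) := by
      have h3 : (ℓ + 1) * j ≤ n + ℓ := Nat.mul_div_le (n + ℓ) (ℓ + 1)
      exact_mod_cast (by omega : (ℓ + 1) * j ≤ n + (ℓ + 1))
    have h3 : (0 : ℝ) ≤ ((ℓ + 1 : ℕ) : ℝ) := by positivity
    have h4 := mul_le_mul_of_nonneg_left h1 h3
    have h5 := mul_le_mul_of_nonneg_left h2 hθv.le
    nlinarith
  · rw [zeroEnd, Nat.add_sub_cancel_left]
    refine Nat.floor_le_floor ?_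
    have : (zeroStart A θ i : ℝ) ≤ j := by exact_mod_cast hi
    gcongr

theorem le_betaExp (hβ : 1 < β) (h : ZeroParameters A θ v)
    (ha : IsBlockSequence β A θ v ℓ a) :
    ((θ * v : ℝ) : EReal) ≤ betaExp β (blockSum β ℓ a 0) := by
  refine EReal.ge_of_forall_gt_iff_ge.1 fun u hu => ?_
  have hu' : u < θ * v := EReal.coe_lt_coe_iff.1 hu
  refine le_betaExp_of_frequently hβ ?_
  have htend : Tendsto (fun i => (ℓ + 1) * zeroStart A θ i) atTop atTop :=
    h.tendsto_zeroStart.const_mul_atTop' (Nat.succ_pos ℓ)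
  refine htend.frequently (Eventually.frequently ?_)
  have hlim : Tendsto (fun i : ℕ => (θ * v - u) * (zeroStart A θ i : ℝ)) atTop atTop :=
    (tendsto_natCast_atTop_atTop.comp h.tendsto_zeroStart).const_mul_atTop (by linarith)
  filter_upwards [hlim.eventually_ge_atTop 1, htend.eventually_ge_atTop 1] with i hi hi1
  refine ⟨hi1, (ha.iterate_zeroStart_lt hβ i).trans_le ?_⟩
  refine Real.rpow_le_rpow_of_exponent_le hβ.le (neg_le_neg ?_)
  rw [Nat.cast_mul, mul_left_comm]
  exact mul_le_mul_of_nonneg_left (by linarith) (by positivity)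

/-- Test `N` one block before the `i`-th zero run: all earlier runs have length at most `θv ·
Aθ^(i-1) = v · Aθ^i`, about `v` times the position. -/
theorem betaUniformExp_le (hβ : 1 < β) (h : ZeroParameters A θ v)
    (ha : IsBlockSequence β A θ v ℓ a) :
    betaUniformExp β (blockSum β ℓ a 0) ≤ (v : EReal) := by
  refine EReal.le_of_forall_lt_iff_le.1 fun u hu => ?_
  have hu' : v < u := EReal.coe_lt_coe_iff.1 hu
  have hv := h.v_pos
  have hθ := h.theta_pos
  refine betaUniformExp_le_of_frequently hβ ?_
  have htend : Tendsto (fun i => (ℓ + 1) * (zeroStart A θ i - 1)) atTop atTop :=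
    ((tendsto_sub_atTop_nat 1).comp h.tendsto_zeroStart).const_mul_atTop' (Nat.succ_pos ℓ)
  refine htend.frequently (Eventually.frequently ?_)
  have hlim : Tendsto (fun i : ℕ => (u - v) * (zeroStart A θ i : ℝ)) atTop atTop :=
    (tendsto_natCast_atTop_atTop.comp h.tendsto_zeroStart).const_mul_atTop (by linarith)
  filter_upwards [hlim.eventually_ge_atTop (u + v + 2), h.tendsto_zeroStart.eventually_ge_atTop 1]
    with i hi hi1 n _ hn
  refine le_trans (Real.rpow_le_rpow_of_exponent_le hβ.le (neg_le_neg ?_))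
    (ha.rpow_le_iterate hβ h (n := n) (B := ⌊v * (A * θ ^ i)⌋₊) fun k hk => ?_)
  · have h1 : (⌊v * (A * θ ^ i)⌋₊ : ℝ) ≤ v * (A * θ ^ i) :=
      Nat.floor_le (mul_nonneg hv.le (h.scale_pos i).le)
    have h2 := mul_lt_mul_of_pos_left (lt_zeroStart A θ i) hv
    rw [Nat.cast_mul, Nat.cast_sub hi1, mul_left_comm u]
    refine mul_le_mul_of_nonneg_left ?_ (by positivity)
    push_cast
    linarith
  · have hki : k < i := by
      have h1 : (n + ℓ) / (ℓ + 1) ≤ zeroStart A θ i - 1 := by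
        rw [Nat.div_le_iff_le_mul_add_pred (Nat.succ_pos ℓ)]
        simp only [Nat.succ_eq_add_one, Nat.add_sub_cancel]
        omega
      exact h.strictMono_zeroStart.lt_iff_lt.1 (by omega)
    rw [zeroEnd, Nat.add_sub_cancel_left]
    refine Nat.floor_le_floor ?_
    have h2 : θ ^ (k + 1) ≤ θ ^ i := pow_le_pow_right₀ h.one_lt.le hki
    have h3 := h.A_pos
    calc θ * v * zeroStart A θ k ≤ θ * v * (A * θ ^ k) := by
          gcongr
          exact h.zeroStart_le k
      _ = v * (A * θ ^ (k + 1)) := by ring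
      _ ≤ v * (A * θ ^ i) := by gcongr

/-- For `N` between the starts of runs `i` and `i + 1`, the start of run `i` is the witness: its
length is about `v · Aθ^(i+1)`, hence nearly `v` times the block position of `N`. -/
theorem le_betaUniformExp (hβ : 1 < β) (h : ZeroParameters A θ v)
    (ha : IsBlockSequence β A θ v ℓ a) :
    (v : EReal) ≤ betaUniformExp β (blockSum β ℓ a 0) := by
  refine EReal.ge_of_forall_gt_iff_ge.1 fun u hu => ?_
  have hu' : u < v := EReal.coe_lt_coe_iff.1 hu
  have hv := h.v_pos
  have hθ := h.theta_pos
  refine le_betaUniformExp_of_eventually hβ ?_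
  have hlim : Tendsto (fun N : ℕ => (v - u) * (N : ℝ)) atTop atTop :=
    tendsto_natCast_atTop_atTop.const_mul_atTop (by linarith)
  filter_upwards [hlim.eventually_ge_atTop (((ℓ + 1 : ℕ) : ℝ) * (θ * v + 1)),
    eventually_ge_atTop ((ℓ + 1) * zeroStart A θ 1)] with N hN hN1
  -- The first run may start at `0`, which is not an admissible time; beyond `zeroStart A θ 1` the
  -- witness is positive.
  have hpos1 : 1 ≤ zeroStart A θ 1 := by
    have := h.strictMono_zeroStart (show 0 < 1 by omega)
    omega
  have hN2 : zeroStart A θ 1 ≤ N / (ℓ + 1) := by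
    rw [Nat.le_div_iff_mul_le (Nat.succ_pos ℓ), mul_comm]
    exact hN1
  obtain ⟨i, hi1, hi2⟩ := h.exists_between
    ((h.strictMono_zeroStart.monotone (Nat.zero_le 1)).trans hN2)
  have hi0 : 1 ≤ zeroStart A θ i := by
    have : 1 < i + 1 := h.strictMono_zeroStart.lt_iff_lt.1 (by omega)
    exact hpos1.trans (h.strictMono_zeroStart.monotone (by omega))
  refine ⟨(ℓ + 1) * zeroStart A θ i, Nat.mul_pos (Nat.succ_pos ℓ) hi0, ?_,
    (ha.iterate_zeroStart_lt hβ i).trans_le ?_⟩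
  · rw [Nat.le_div_iff_mul_le (Nat.succ_pos ℓ), mul_comm] at hi1
    exact hi1
  refine Real.rpow_le_rpow_of_exponent_le hβ.le (neg_le_neg ?_)
  have h1 : (N : ℝ) ≤ ((ℓ + 1 : ℕ) : ℝ) * (A * θ ^ (i + 1)) := by
    have h2 : N < (ℓ + 1) * zeroStart A θ (i + 1) := by
      rw [Nat.div_lt_iff_lt_mul (Nat.succ_pos ℓ), mul_comm] at hi2
      exact hi2
    have h3 : (N : ℝ) ≤ ((ℓ + 1 : ℕ) : ℝ) * zeroStart A θ (i + 1) := by exact_mod_cast h2.le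
    refine h3.trans ?_
    gcongr
    exact h.zeroStart_le _
  have h2 : θ * v * (A * θ ^ i - 1) ≤ θ * v * zeroStart A θ i := by
    gcongr
    exact (lt_zeroStart A θ i).le
  have h3 := mul_le_mul_of_nonneg_left h1 hv.le
  have h4 : (0 : ℝ) ≤ ((ℓ + 1 : ℕ) : ℝ) := by positivity
  have h5 := mul_le_mul_of_nonneg_left h2 h4
  rw [pow_succ] at h3
  nlinarith

end IsBlockSequence

/-! ### A Cantor set of points with prescribed exponents -/

/-- The digit of rank `r` of `s` in base `M`. -/
noncomputable def baseDigit (M : ℕ) (s : ℝ) (r : ℕ) : ℕ := ⌊(M : ℝ) ^ (r + 1) * s⌋₊ % M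

theorem floor_eq_of_baseDigit_eq {M : ℕ} (hM : 0 < M) {s s' : ℝ} (hs : s ∈ Ico (0 : ℝ) 1)
    (hs' : s' ∈ Ico (0 : ℝ) 1) {R : ℕ} (h : ∀ r < R, baseDigit M s r = baseDigit M s' r) :
    ⌊(M : ℝ) ^ R * s⌋₊ = ⌊(M : ℝ) ^ R * s'⌋₊ := by
  have hM0 : (M : ℝ) ≠ 0 := by exact_mod_cast hM.ne'
  induction R with
  | zero =>
    rw [pow_zero, one_mul, one_mul, Nat.floor_eq_zero.2 hs.2, Nat.floor_eq_zero.2 hs'.2]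
  | succ R ih =>
    have hdiv : ∀ t : ℝ, ⌊(M : ℝ) ^ (R + 1) * t⌋₊ / M = ⌊(M : ℝ) ^ R * t⌋₊ := fun t => by
      rw [← Nat.floor_div_natCast]
      congr 1
      field_simp
      ring
    have h1 := ih fun r hr => h r (by omega)
    have h2 := h R (by omega)
    rw [← hdiv, ← hdiv] at h1
    rw [← Nat.div_add_mod ⌊(M : ℝ) ^ (R + 1) * s⌋₊ M,
      ← Nat.div_add_mod ⌊(M : ℝ) ^ (R + 1) * s'⌋₊ M, h1]
    exact congrArg _ h2

theorem abs_sub_le_of_baseDigit_eq {M : ℕ} (hM : 0 < M) {s s' : ℝ} (hs : s ∈ Ico (0 : ℝ) 1)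
    (hs' : s' ∈ Ico (0 : ℝ) 1) {R : ℕ} (h : ∀ r < R, baseDigit M s r = baseDigit M s' r) :
    |s - s'| ≤ ((M : ℝ) ^ R)⁻¹ := by
  have hM0 : (0 : ℝ) < (M : ℝ) ^ R := by positivity
  have h1 := floor_eq_of_baseDigit_eq hM hs hs' h
  have h2 := Nat.floor_le (mul_nonneg hM0.le hs.1)
  have h3 := Nat.floor_le (mul_nonneg hM0.le hs'.1)
  have h4 := Nat.lt_floor_add_one ((M : ℝ) ^ R * s)
  have h5 := Nat.lt_floor_add_one ((M : ℝ) ^ R * s')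
  rw [h1] at h2 h4
  have h6 : |(M : ℝ) ^ R * (s - s')| ≤ 1 := by
    rw [abs_le]
    constructor <;> linarith
  rwa [abs_mul, abs_of_pos hM0, mul_comm, ← le_div_iff₀ hM0, one_div] at h6

theorem eq_of_baseDigit_eq {M : ℕ} (hM : 1 < M) {s s' : ℝ} (hs : s ∈ Ico (0 : ℝ) 1)
    (hs' : s' ∈ Ico (0 : ℝ) 1) (h : ∀ r, baseDigit M s r = baseDigit M s' r) : s = s' := by
  have hlim : Tendsto (fun R : ℕ => ((M : ℝ) ^ R)⁻¹) atTop (nhds 0) := by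
    simp only [← inv_pow]
    exact tendsto_pow_atTop_nhds_zero_of_lt_one (by positivity)
      (inv_lt_one_of_one_lt₀ (by exact_mod_cast hM))
  have h0 : |s - s'| ≤ 0 := ge_of_tendsto' hlim fun R =>
    abs_sub_le_of_baseDigit_eq (by omega) hs hs' fun r _ => h r
  exact sub_eq_zero.1 (abs_nonpos_iff.1 h0)

open Classical in
/-- The sequence of blocks which writes the base `M` digits of `s`, translated by `e`, at the free
positions. -/
noncomputable def digitBlocks (A θ v : ℝ) (M : ℕ) (e : ℕ → ℝ) (s : ℝ) (j : ℕ) : ℝ :=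
  if j ∈ zeroPositions A θ v then 0 else e (baseDigit M s (freeCount A θ v j))

theorem isBlockSequence_digitBlocks {β A θ v : ℝ} (hβ : 1 < β) {ℓ M : ℕ} (hM : 0 < M) {e : ℕ → ℝ}
    (he : ∀ i < M, e i ∈ fullOffsets β ℓ ∧ e i ≠ 0) (s : ℝ) :
    IsBlockSequence β A θ v ℓ (digitBlocks A θ v M e s) where
  mem j := by
    unfold digitBlocks
    split_ifs
    · exact fullOffsets_mono hβ (Nat.zero_le ℓ) (zero_mem_fullOffsets_zero β)
    · exact (he _ (Nat.mod_lt _ hM)).1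
  zero j hj := if_pos hj
  ne_zero j hj := by
    rw [digitBlocks, if_neg hj]
    exact (he _ (Nat.mod_lt _ hM)).2

/-- Before the first disagreement at `j`, every free position carries equal digits, so `s` and `s'`
share their first `freeCount A θ v j` digits. -/
theorem exists_first_digitBlocks_ne {A θ v : ℝ} (h : ZeroParameters A θ v) {M : ℕ} (hM : 1 < M)
    {e : ℕ → ℝ} (he : InjOn e (Iio M)) {s s' : ℝ} (hs : s ∈ Ico (0 : ℝ) 1)
    (hs' : s' ∈ Ico (0 : ℝ) 1) (hne : s ≠ s') :
    ∃ j, digitBlocks A θ v M e s j ≠ digitBlocks A θ v M e s' j ∧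
      (∀ i < j, digitBlocks A θ v M e s i = digitBlocks A θ v M e s' i) ∧
      |s - s'| ≤ ((M : ℝ) ^ freeCount A θ v j)⁻¹ := by
  classical
  have hdigit : ∀ j ∉ zeroPositions A θ v,
      digitBlocks A θ v M e s j = digitBlocks A θ v M e s' j →
      baseDigit M s (freeCount A θ v j) = baseDigit M s' (freeCount A θ v j) := by
    intro j hj hjj
    rw [digitBlocks, digitBlocks, if_neg hj, if_neg hj] at hjj
    exact he (Nat.mod_lt _ (by omega)) (Nat.mod_lt _ (by omega)) hjj
  have hfree : ∀ r, Nat.nth (· ∉ zeroPositions A θ v) r ∉ zeroPositions A θ v ∧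
      freeCount A θ v (Nat.nth (· ∉ zeroPositions A θ v) r) = r := fun r =>
    ⟨Nat.nth_mem_of_infinite h.infinite_setOf_notMem r,
      Nat.count_nth_of_infinite h.infinite_setOf_notMem r⟩
  have hex : ∃ j, digitBlocks A θ v M e s j ≠ digitBlocks A θ v M e s' j := by
    by_contra! hc
    refine hne (eq_of_baseDigit_eq hM hs hs' fun r => ?_)
    have := hdigit _ (hfree r).1 (hc _)
    rwa [(hfree r).2] at this
  have hmin : ∀ i < Nat.find hex, digitBlocks A θ v M e s i = digitBlocks A θ v M e s' i :=
    fun i hi => not_not.1 (Nat.find_min hex hi)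
  refine ⟨Nat.find hex, Nat.find_spec hex, hmin, ?_⟩
  refine abs_sub_le_of_baseDigit_eq (by omega) hs hs' fun r hr => ?_
  have := hdigit _ (hfree r).1 (hmin _ (Nat.nth_lt_of_lt_count hr))
  rwa [(hfree r).2] at this

/-- If the sequences first differ at `j`, then `|s - s'| ≤ M^(1 - σj) ≤ M β^(-(ℓ+1)tj)`, while the
points are at least a constant times `β^(-(ℓ+1)j)` apart. The factor `M` pays for the `-1` in
`le_freeCount`. -/
theorem exists_abs_sub_le_blockSum {β A θ v σ t : ℝ} (hβ : 1 < β) (h : ZeroParameters A θ v)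
    (hσ : σ = (θ - 1 - θ * v) / ((1 + θ * v) * (θ - 1))) (ht : 0 < t) {ℓ M : ℕ} (hM : 1 < M)
    (hMt : β ^ (((ℓ + 1 : ℕ) : ℝ) * t) ≤ (M : ℝ) ^ σ) {e : ℕ → ℝ} (hinj : InjOn e (Iio M))
    (he : ∀ i < M, e i ∈ fullOffsets β ℓ ∧ e i ≠ 0) :
    ∃ C : NNReal, ∀ s ∈ Ico (0 : ℝ) 1, ∀ s' ∈ Ico (0 : ℝ) 1, |s - s'| ≤
      C * |blockSum β ℓ (digitBlocks A θ v M e s) 0 -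
        blockSum β ℓ (digitBlocks A θ v M e s') 0| ^ t := by
  have hβ0 : 0 < β := by linarith
  have hM0 : (0 : ℝ) < M := by exact_mod_cast (by omega : 0 < M)
  set c := (β ^ ℓ)⁻¹ - (β ^ (ℓ + 1))⁻¹ with hc
  have hc0 : 0 < c := sub_pos.2 (inv_pow_succ_lt_inv_pow hβ ℓ)
  have hC0 : 0 ≤ M * (c ^ t)⁻¹ := by positivity
  refine ⟨(M * (c ^ t)⁻¹).toNNReal, fun s hs s' hs' => ?_⟩
  rw [Real.coe_toNNReal _ hC0]
  rcases eq_or_ne s s' with rfl | hne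
  · rw [sub_self, abs_zero]
    positivity
  obtain ⟨j, hj, hlt, hle⟩ := exists_first_digitBlocks_ne h hM hinj hs hs' hne
  have hseq := fun s => (isBlockSequence_digitBlocks (A := A) (θ := θ) (v := v) hβ
    (by omega : 0 < M) he s).mem
  have hdist := le_abs_blockSum_sub hβ (hseq s) (hseq s') hlt hj
  have hb0 : (0 : ℝ) < ((β ^ (ℓ + 1))⁻¹) ^ j := by positivity
  have h1 : ((M : ℝ) ^ freeCount A θ v j)⁻¹ ≤ M * (((β ^ (ℓ + 1))⁻¹) ^ j) ^ t := by
    have h2 := h.le_freeCount hσ j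
    have hM1 : (1 : ℝ) ≤ M := by exact_mod_cast hM.le
    calc ((M : ℝ) ^ freeCount A θ v j)⁻¹ = (M : ℝ) ^ (-(freeCount A θ v j : ℝ)) := by
          rw [Real.rpow_neg hM0.le, Real.rpow_natCast]
      _ ≤ (M : ℝ) ^ (1 + -(σ * j)) := Real.rpow_le_rpow_of_exponent_le hM1 (by linarith)
      _ = M * (((M : ℝ) ^ σ) ^ j)⁻¹ := by
          rw [Real.rpow_add hM0, Real.rpow_one, Real.rpow_neg hM0.le, Real.rpow_mul_natCast hM0.le]
      _ ≤ M * ((β ^ (((ℓ + 1 : ℕ) : ℝ) * t)) ^ j)⁻¹ := by gcongr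
      _ = M * (((β ^ (ℓ + 1))⁻¹) ^ j) ^ t := by
          rw [inv_pow_pow_eq_rpow hβ, ← Real.rpow_mul hβ0.le, ← Real.rpow_mul_natCast hβ0.le,
            ← Real.rpow_neg hβ0.le]
          congr 2
          ring
  refine (hle.trans h1).trans ?_
  rw [mul_assoc]
  gcongr
  rw [le_inv_mul_iff₀ (by positivity), ← Real.mul_rpow hc0.le hb0.le]
  refine Real.rpow_le_rpow (by positivity) ?_ ht.le
  rwa [mul_comm]

/-- The hypothesis makes `f` injective on `S` with a `t`-Hölder inverse, which multiplies dimension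
by at most `1/t`. -/
theorem mul_dimH_le_dimH_image {f : ℝ → ℝ} {S : Set ℝ} {C t : NNReal} (ht : 0 < t)
    (h : ∀ x ∈ S, ∀ y ∈ S, |x - y| ≤ C * |f x - f y| ^ (t : ℝ)) :
    t * dimH S ≤ dimH (f '' S) := by
  classical
  have hinj : InjOn f S := fun x hx y hy hxy => by
    have := h x hx y hy
    rw [hxy, sub_self, abs_zero, Real.zero_rpow (by exact_mod_cast ht.ne'), mul_zero] at this
    exact sub_eq_zero.1 (abs_nonpos_iff.1 this)
  have hleft : LeftInvOn (Function.invFunOn f S) f S := hinj.leftInvOn_invFunOn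
  have hhold : HolderOnWith C t (Function.invFunOn f S) (f '' S) := by
    rintro _ ⟨x, hx, rfl⟩ _ ⟨y, hy, rfl⟩
    rw [hleft hx, hleft hy, edist_dist, edist_dist, Real.dist_eq, Real.dist_eq,
      ENNReal.ofReal_rpow_of_nonneg (abs_nonneg _) t.coe_nonneg, ← ENNReal.ofReal_coe_nnreal,
      ← ENNReal.ofReal_mul C.coe_nonneg]
    exact ENNReal.ofReal_le_ofReal (h x hx y hy)
  have h1 := hhold.dimH_image_le ht
  rw [hleft.image_image, ENNReal.le_div_iff_mul_le (Or.inl (by simpa using ht.ne'))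
    (Or.inl ENNReal.coe_ne_top), mul_comm] at h1
  exact h1

/-- There are nearly `β ^ ℓ` nonzero full offsets. -/
theorem exists_rpow_le_ncard {β κ : ℝ} (hβ : 1 < β) (hκ : κ < 1) :
    ∃ ℓ : ℕ, β ^ (κ * (ℓ + 1 : ℕ)) + 1 ≤ ((fullOffsets β ℓ \ {0}).ncard : ℝ) := by
  have hβ0 : 0 < β := by linarith
  -- It suffices that `(ℓ+1)(β^(κ(ℓ+1)) + 2) < β^ℓ`. After division by `β^(ℓ+1)` the left side is a
  -- sum of two null sequences. The `2` pays for removing the offset `0` and for the `+ 1` in the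
  -- claim.
  have h1 := tendsto_self_mul_const_pow_of_lt_one (r := β ^ (-(1 - κ))) (by positivity)
    (Real.rpow_lt_one_of_one_lt_of_neg hβ (by linarith))
  have h2 := (tendsto_self_mul_const_pow_of_lt_one (r := β⁻¹) (by positivity)
    (inv_lt_one_of_one_lt₀ hβ)).const_mul 2
  have h3 := h1.add h2
  rw [mul_zero, add_zero] at h3
  obtain ⟨ℓ, hℓ⟩ := (((tendsto_add_atTop_iff_nat 1).2 h3).eventually
    (gt_mem_nhds (inv_pos.2 hβ0))).exists
  refine ⟨ℓ, ?_⟩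
  have hfin := (fullOffsets_finite_and_ncard_le hβ ℓ).1
  have hcard := pow_le_ncard_fullOffsets hβ ℓ
  have h4 : (fullOffsets β ℓ).ncard ≤ (fullOffsets β ℓ \ {0}).ncard + 1 :=
    (pred_ncard_le_ncard_sdiff_singleton _ _) |> Nat.le_add_of_sub_le
  have h4' : ((fullOffsets β ℓ).ncard : ℝ) ≤ (fullOffsets β ℓ \ {0}).ncard + 1 := by
    exact_mod_cast h4
  have h5 : (β ^ (-(1 - κ))) ^ (ℓ + 1) = β ^ (κ * (ℓ + 1 : ℕ)) * (β ^ (ℓ + 1))⁻¹ := by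
    rw [← Real.rpow_mul_natCast hβ0.le, ← Real.rpow_natCast β, ← Real.rpow_neg hβ0.le,
      ← Real.rpow_add hβ0]
    congr 1
    ring
  rw [h5, inv_pow] at hℓ
  have hp : (0 : ℝ) < β ^ (ℓ + 1) := by positivity
  have h6 : ((ℓ + 1 : ℕ) : ℝ) * (β ^ (κ * (ℓ + 1 : ℕ)) + 2) < β ^ ℓ := by
    have h7 := mul_lt_mul_of_pos_right hℓ hp
    have h8 : β⁻¹ * β ^ (ℓ + 1) = β ^ ℓ := by rw [pow_succ]; field_simp
    have h9 : (β ^ (ℓ + 1))⁻¹ * β ^ (ℓ + 1) = 1 := inv_mul_cancel₀ hp.ne'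
    rw [h8] at h7
    calc _ = ((ℓ + 1 : ℕ) : ℝ) * (β ^ (κ * (ℓ + 1 : ℕ)) * ((β ^ (ℓ + 1))⁻¹ * β ^ (ℓ + 1))) +
          2 * (((ℓ + 1 : ℕ) : ℝ) * ((β ^ (ℓ + 1))⁻¹ * β ^ (ℓ + 1))) := by rw [h9]; ring
      _ < _ := by linarith
  have h10 : ((ℓ + 1 : ℕ) : ℝ) * (β ^ (κ * (ℓ + 1 : ℕ)) + 2) <
      ((ℓ + 1 : ℕ) : ℝ) * (fullOffsets β ℓ).ncard := by
    refine h6.trans_le (hcard.trans_eq ?_)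
    push_cast
    ring
  have h11 := lt_of_mul_lt_mul_left h10 (by positivity)
  linarith

theorem exists_injOn_of_finite {S : Set ℝ} (hS : S.Finite) :
    ∃ e : ℕ → ℝ, InjOn e (Iio S.ncard) ∧ ∀ i < S.ncard, e i ∈ S := by
  have hcard := ncard_eq_toFinset_card S hS
  refine ⟨fun i => if hi : i < S.ncard then
    (hS.toFinset.equivFin.symm ⟨i, hcard ▸ hi⟩ : ℝ) else 0, fun i hi j hj hij => ?_,
    fun i hi => ?_⟩
  · simp only [mem_Iio] at hi hj
    simp only [hi, hj, dif_pos] at hij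
    simpa using hij
  · simp only [hi, dif_pos]
    exact hS.mem_toFinset.1 (hS.toFinset.equivFin.symm ⟨i, hcard ▸ hi⟩).2

theorem le_dimH_level_set {β v θ : ℝ} (hβ : 1 < β) (hv : 0 < v) (hv1 : v < 1)
    (hθ : 1 / (1 - v) ≤ θ) :
    ENNReal.ofReal ((θ - 1 - θ * v) / ((1 + θ * v) * (θ - 1))) ≤
    dimH {x : ℝ | x ∈ Icc (0 : ℝ) 1 ∧ betaUniformExp β x = (v : EReal) ∧
      betaExp β x = ((θ * v : ℝ) : EReal)} := by
  have hβ0 : 0 < β := by linarith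
  set σ := (θ - 1 - θ * v) / ((1 + θ * v) * (θ - 1)) with hσ
  refine ENNReal.le_of_forall_nnreal_lt fun t ht => ?_
  rcases eq_or_lt_of_le (zero_le (a := t)) with rfl | ht0
  · simp
  have htσ : (t : ℝ) < σ := by
    have := (ENNReal.lt_ofReal_iff_toReal_lt ENNReal.coe_ne_top).1 ht
    simpa using this
  have ht0' : (0 : ℝ) < t := ht0
  have hσ0 : 0 < σ := ht0'.trans htσ
  have hθv : 1 ≤ θ * (1 - v) := (div_le_iff₀ (by linarith)).1 hθ
  have hθ0 : 0 < θ := by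
    by_contra! h
    nlinarith
  have hθ1 : 1 < θ := by nlinarith
  have hnum : 0 < θ - 1 - θ * v := by
    by_contra! hc
    have : σ ≤ 0 := div_nonpos_of_nonpos_of_nonneg hc
      (mul_nonneg (by positivity) (by linarith))
    linarith
  have h : ZeroParameters (2 / (θ - 1 - θ * v)) θ v :=
    ⟨hθ1, hv, by positivity, by rw [div_mul_cancel₀ _ hnum.ne']; norm_num⟩
  -- The rate `κ = t/σ < 1` is chosen so that `M^σ ≥ β^((ℓ+1)t)`.
  obtain ⟨ℓ, hℓ⟩ := exists_rpow_le_ncard hβ ((div_lt_one hσ0).2 htσ)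
  set M := (fullOffsets β ℓ \ {0}).ncard with hM
  have hM1 : 1 < M := by
    have : 0 < β ^ (t / σ * (ℓ + 1 : ℕ)) := by positivity
    have : (1 : ℝ) < M := by linarith
    exact_mod_cast this
  have hMt : β ^ (((ℓ + 1 : ℕ) : ℝ) * t) ≤ (M : ℝ) ^ σ := by
    calc β ^ (((ℓ + 1 : ℕ) : ℝ) * t) = (β ^ (t / σ * (ℓ + 1 : ℕ))) ^ σ := by
          rw [← Real.rpow_mul hβ0.le]
          congr 1
          field_simp
      _ ≤ (M : ℝ) ^ σ := by
          gcongr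
          linarith
  obtain ⟨e, hinj, he⟩ := exists_injOn_of_finite
    ((fullOffsets_finite_and_ncard_le hβ ℓ).1.sdiff (t := {0}))
  obtain ⟨C, hC⟩ := exists_abs_sub_le_blockSum hβ h hσ ht0' hM1 hMt hinj he
  have hdim := mul_dimH_le_dimH_image ht0 hC
  have hone : dimH (Ico (0 : ℝ) 1) = 1 := by
    rw [Real.dimH_of_nonempty_interior (by rw [interior_Ico]; exact nonempty_Ioo.2 one_pos)]
    simp
  rw [hone, mul_one] at hdim
  refine hdim.trans (dimH_mono ?_)
  rintro _ ⟨s, -, rfl⟩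
  have hseq := isBlockSequence_digitBlocks (A := 2 / (θ - 1 - θ * v)) (θ := θ) (v := v) hβ
    (by omega : 0 < M) he s
  exact ⟨Ico_subset_Icc_self (blockSum_mem_Ico hβ hseq.mem 0),
    le_antisymm (hseq.betaUniformExp_le hβ h) (hseq.le_betaUniformExp hβ h),
    le_antisymm (hseq.betaExp_le hβ h) (hseq.le_betaExp hβ h)⟩

/-! ### Empty level sets, uniform exponent one, and the theorem -/

theorem level_set_eq_empty {β v θ : ℝ} (hβ : 1 < β) (hv : 0 < v) (hv1 : v < 1)
    (hθ : θ < 1 / (1 - v)) :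
    {x : ℝ | x ∈ Icc (0 : ℝ) 1 ∧ (v : EReal) ≤ betaUniformExp β x} ∩
      {x : ℝ | x ∈ Icc (0 : ℝ) 1 ∧ betaExp β x = ((θ * v : ℝ) : EReal)} = ∅ := by
  refine eq_empty_of_forall_notMem ?_
  rintro x ⟨⟨hx, hxv⟩, -, hxe⟩
  have hlt : θ * v < v / (1 - v) := by
    have := mul_lt_mul_of_pos_right hθ hv
    rwa [one_div_mul_eq_div] at this
  obtain ⟨u, hu1, hu2⟩ := exists_between hlt
  refine absurd (div_one_sub_le_of_betaExp_lt hβ hx.1 hv hv1 hxv (u := u) ?_) (not_le.2 hu2)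
  rw [hxe]
  exact EReal.coe_lt_coe_iff.2 hu1

theorem betaExp_eq_top_of_betaUniformExp_eq_one {β x : ℝ} (hβ : 1 < β) (hx : 0 ≤ x)
    (h : betaUniformExp β x = 1) : betaExp β x = ⊤ := by
  by_contra hne
  obtain ⟨u, hu1, hu2⟩ := EReal.lt_iff_exists_real_btwn.1 (lt_top_iff_ne_top.2 hne)
  set w := max u 1 with hw
  have hw1 : 1 ≤ w := le_max_right _ _
  have hlt : betaExp β x < w := hu1.trans_le (EReal.coe_le_coe_iff.2 (le_max_left _ _))
  -- For `v = (w+1)/(w+2)` one has `v/(1-v) = w + 1`, which contradicts the bound `v/(1-v) ≤ w`.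
  have hv1 : (w + 1) / (w + 2) < 1 := by rw [div_lt_one (by linarith)]; linarith
  have hle : (((w + 1) / (w + 2) : ℝ) : EReal) ≤ betaUniformExp β x := by
    rw [h]
    exact_mod_cast hv1.le
  have h1 := div_one_sub_le_of_betaExp_lt hβ hx (by positivity) hv1 hle hlt
  have h2 : (w + 1) / (w + 2) / (1 - (w + 1) / (w + 2)) = w + 1 := by
    have : w + 2 ≠ 0 := by linarith
    have h3 : 1 - (w + 1) / (w + 2) = 1 / (w + 2) := by
      field_simp
      ring
    rw [h3]
    field_simp
  linarith

theorem theorem1p4 (β : ℝ) (hβ : 1 < β) :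
    (∀ θ v : ℝ, 0 < θ → 0 < v → v < 1 →
      (θ < 1 / (1 - v) →
        {x : ℝ | x ∈ Icc (0 : ℝ) 1 ∧ (v : EReal) ≤ betaUniformExp β x} ∩
          {x : ℝ | x ∈ Icc (0 : ℝ) 1 ∧ betaExp β x = ((θ * v : ℝ) : EReal)} = ∅) ∧
      (1 / (1 - v) ≤ θ →
        dimH ({x : ℝ | x ∈ Icc (0 : ℝ) 1 ∧ betaUniformExp β x = (v : EReal)} ∩
          {x : ℝ | x ∈ Icc (0 : ℝ) 1 ∧ betaExp β x = ((θ * v : ℝ) : EReal)}) =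
          ENNReal.ofReal ((θ - 1 - θ * v) / ((1 + θ * v) * (θ - 1))))) ∧
    dimH {x : ℝ | x ∈ Icc (0 : ℝ) 1 ∧ betaUniformExp β x = 1} = 0 := by
  refine ⟨fun θ v _ hv hv1 => ⟨level_set_eq_empty hβ hv hv1, fun hθ => le_antisymm ?_ ?_⟩, ?_⟩
  · refine (dimH_mono ?_).trans (dimH_level_set_le hβ hv hv1 hθ)
    exact fun x hx => ⟨hx.1.1, hx.1.2.ge, hx.2.2⟩
  · refine (le_dimH_level_set hβ hv hv1 hθ).trans (dimH_mono ?_)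
    exact fun x hx => ⟨⟨hx.1, hx.2.1⟩, hx.1, hx.2.2⟩
  · refine le_antisymm ((dimH_mono ?_).trans_eq (dimH_betaExp_eq_top hβ)) zero_le
    exact fun x hx => ⟨hx.1, betaExp_eq_top_of_betaUniformExp_eq_one hβ hx.1.1 hx.2⟩
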